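/- Let $\mathcal L=\sum_{i<j}L_{ij}[u]\,dx^i\wedge dx^j$ be a 2-form on $\mathbb R^n$ whose coefficients $L_{ij}[u]=L_{ij}(u,u_k,u_{km})$, $L_{ij}=-L_{ji}$, are smooth real functions of the second jet of a function $u(x^1,\dots,x^n)$, where $u_{km}=u_{mk}$ is a single jet coordinate. For $i\neq j$ put $$\frac{\delta L_{ij}}{\delta u}=\frac{\partial L_{ij}}{\partial u}-D_i\frac{\partial L_{ij}}{\partial u_i}-D_j\frac{\partial L_{ij}}{\partial u_j}+D_i^2\frac{\partial L_{ij}}{\partial u_{ii}}+D_iD_j\frac{\partial L_{ij}}{\partial u_{ij}}+D_j^2\frac{\partial L_{ij}}{\partial u_{jj}},$$ $$\frac{\delta L_{ij}}{\delta u_k}=\frac{\partial L_{ij}}{\partial u_k}-D_i\frac{\partial L_{ij}}{\partial u_{ik}}-D_j\frac{\partial L_{ij}}{\partial u_{jk}},\qquad \frac{\delta L_{ij}}{\delta u_{km}}=\frac{\partial L_{ij}}{\partial u_{km}},$$ where $D_i$ is the total derivative with respect to $x^i$. Let $u:\mathbb R^n\to\mathbb R$ be smooth. Then the following are equivalent.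 (A) For every compact oriented smoothly embedded 2-surface $\Sigma\subset\mathbb R^n$ (possibly with boundary; that is, a compact subset $\Sigma$ of an oriented embedded smooth 2-dimensional submanifold $M\subset\mathbb R^n$, with boundary $\partial\Sigma$ taken relative to $M$), $u$ is a critical point of the action $S_\Sigma[u]=\int_\Sigma\mathcal L$: for every smooth $v:\mathbb R^n\to\mathbb R$ vanishing in a neighbourhood of $\partial\Sigma$, $\frac{d}{d\varepsilon}\big|_{\varepsilon=0}S_\Sigma[u+\varepsilon v]=0$. (B) $u$ satisfies, at every point of $\mathbb R^n$, the multi-time Euler–Lagrange equations 1. $\dfrac{\delta L_{ij}}{\delta u}=0$ for $i\ne j$; 2. $\dfrac{\delta L_{ij}}{\delta u_k}=0$ for $i\neq j$ and $k\notin\{i,j\}$; 3. $\dfrac{\delta L_{ij}}{\delta u_{km}}=0$ for $i\neq j$ and $k,m\notin\{i,j\}$; 4. for every $i$, $\dfrac{\delta L_{ij}}{\delta u_j}$ does not depend on $j\neq i$; 5. for every $i$ and every $k\neq i$, $\dfrac{\delta L_{ij}}{\delta u_{jk}}$ does not depend on $j\neq i$ ($j=k$ allowed); 6. $\dfrac{\delta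 L_{ij}}{\delta u_{ij}}+\dfrac{\delta L_{jk}}{\delta u_{jk}}+\dfrac{\delta L_{ki}}{\delta u_{ki}}=0$ for pairwise distinct $i,j,k$. -/

import Mathlib

open scoped ContDiff Topology

noncomputable section

namespace PluriLagrangian

/-- Multi-time `ℝⁿ` with coordinates `x¹, …, xⁿ`. -/
abbrev MultiTime (n : ℕ) : Type := Fin n → ℝ

/-- Fibre of the second jet space of real functions of `n` variables, with one coordinate `u`,
one coordinate `u_k` for every `k`, and one coordinate `u_{km} = u_{mk}` for every unordered
pair `{k, m}` (with `k = m` allowed). -/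
abbrev Jet2 (n : ℕ) : Type := ℝ × (Fin n → ℝ) × (Sym2 (Fin n) → ℝ)

variable {n : ℕ}

/-- Partial derivative with respect to `x^k`. -/
def pd (k : Fin n) (f : MultiTime n → ℝ) (x : MultiTime n) : ℝ :=
  fderiv ℝ f x (Pi.single k 1)

/-- The second jet `(u, u_k, u_{km})` of a function at a point. For a `C²` function the two mixed
derivatives coincide; their mean is written only to have a function of the unordered pair. -/
def jet2 (u : MultiTime n → ℝ) (x : MultiTime n) : Jet2 n :=
  (u x, fun k => pd k u x,
    Sym2.lift ⟨fun k m => (pd k (pd m u) x + pd m (pd k u) x) / 2,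
      fun k m => by dsimp only; rw [add_comm]⟩)

/-- `∂f/∂u` on the jet space. -/
def dU (f : Jet2 n → ℝ) (p : Jet2 n) : ℝ := fderiv ℝ f p (1, 0, 0)

/-- `∂f/∂u_k` on the jet space. -/
def dU1 (k : Fin n) (f : Jet2 n → ℝ) (p : Jet2 n) : ℝ :=
  fderiv ℝ f p (0, Pi.single k 1, 0)

/-- `∂f/∂u_{km}` on the jet space. -/
def dU2 (k m : Fin n) (f : Jet2 n → ℝ) (p : Jet2 n) : ℝ :=
  fderiv ℝ f p (0, 0, Pi.single s(k, m) 1)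

/-- The differential function `f[u]`, as a function on multi-time. The total derivative `D_i f`
along the field `u` is `pd i (along u f)`. -/
def along (u : MultiTime n → ℝ) (f : Jet2 n → ℝ) (x : MultiTime n) : ℝ := f (jet2 u x)

/-- `δf/δu` in the `(x^i, x^j)`-plane, evaluated on the field `u`. -/
def var0 (i j : Fin n) (f : Jet2 n → ℝ) (u : MultiTime n → ℝ) (x : MultiTime n) : ℝ :=
  along u (dU f) x
    - pd i (along u (dU1 i f)) x
    - pd j (along u (dU1 j f)) x
    + pd i (pd i (along u (dU2 i i f))) x
    + pd i (pd j (along u (dU2 i j f))) x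
    + pd j (pd j (along u (dU2 j j f))) x

/-- `δf/δu_k` in the `(x^i, x^j)`-plane, evaluated on the field `u`. -/
def var1 (i j k : Fin n) (f : Jet2 n → ℝ) (u : MultiTime n → ℝ) (x : MultiTime n) : ℝ :=
  along u (dU1 k f) x
    - pd i (along u (dU2 i k f)) x
    - pd j (along u (dU2 j k f)) x

/-- `δf/δu_{km} = ∂f/∂u_{km}`, evaluated on the field `u`. -/
def var2 (k m : Fin n) (f : Jet2 n → ℝ) (u : MultiTime n → ℝ) (x : MultiTime n) : ℝ :=
  along u (dU2 k m f) x

/-- The system of multi-time Euler–Lagrange equations for a field `u`. -/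
structure MultiTimeEL (L : Fin n → Fin n → Jet2 n → ℝ) (u : MultiTime n → ℝ) : Prop where
  eq_u : ∀ i j, i ≠ j → ∀ x, var0 i j (L i j) u x = 0
  eq_uk : ∀ i j k, i ≠ j → k ≠ i → k ≠ j → ∀ x, var1 i j k (L i j) u x = 0
  eq_ukm : ∀ i j k m, i ≠ j → k ≠ i → k ≠ j → m ≠ i → m ≠ j →
    ∀ x, var2 k m (L i j) u x = 0
  indep_uj : ∀ i j j', j ≠ i → j' ≠ i →
    ∀ x, var1 i j j (L i j) u x = var1 i j' j' (L i j') u x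
  indep_ujk : ∀ i k j j', k ≠ i → j ≠ i → j' ≠ i →
    ∀ x, var2 j k (L i j) u x = var2 j' k (L i j') u x
  cyclic : ∀ i j k, i ≠ j → j ≠ k → k ≠ i →
    ∀ x, var2 i j (L i j) u x + var2 j k (L j k) u x + var2 k i (L k i) u x = 0

/-- Value of `dx^i ∧ dx^j` on the coordinate tangent vectors of a map `Γ(s, t)`, that is, the
Jacobian `∂(Γ^i, Γ^j)/∂(s, t)`. -/
def minor (Γ : ℝ × ℝ → MultiTime n) (z : ℝ × ℝ) (i j : Fin n) : ℝ :=
  fderiv ℝ Γ z (1, 0) i * fderiv ℝ Γ z (0, 1) j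
    - fderiv ℝ Γ z (0, 1) i * fderiv ℝ Γ z (1, 0) j

/-- A compact oriented surface with boundary in multi-time, given as a compact subset `carrier` of
a smooth embedded oriented two-dimensional submanifold without boundary. That submanifold is the
union of the images of finitely many local parametrizations; no regularity of the boundary of
`carrier` in it is required. -/
structure Surface (n : ℕ) where
  /-- number of local parametrizations -/
  N : ℕ
  /-- parameter domains -/
  dom : Fin N → Set (ℝ × ℝ)
  /-- local parametrizations -/
  param : Fin N → ℝ × ℝ → MultiTime n
  isOpen_dom : ∀ a, IsOpen (dom a)
  smooth : ∀ a, ContDiffOn ℝ ∞ (param a) (dom a)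
  injOn : ∀ a, Set.InjOn (param a) (dom a)
  immersion : ∀ a, ∀ z ∈ dom a, Function.Injective (fderiv ℝ (param a) z)
  /-- The parametrizations are open maps to the union of their images, in the subspace topology. -/
  embedded : ∀ a, ∀ V : Set (ℝ × ℝ), IsOpen V → V ⊆ dom a →
    ∃ W : Set (MultiTime n), IsOpen W ∧ param a '' V = W ∩ ⋃ b, param b '' dom b
  /-- At common points, the tangent bivectors of two parametrizations are positively
  proportional. -/
  oriented : ∀ a b, ∀ z ∈ dom a, ∀ w ∈ dom b, param a z = param b w →
    ∃ c : ℝ, 0 < c ∧ ∀ i j, minor (param a) z i j = c * minor (param b) w i j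
  /-- the surface itself -/
  carrier : Set (MultiTime n)
  isCompact_carrier : IsCompact carrier
  carrier_subset : carrier ⊆ ⋃ a, param a '' dom a

namespace Surface

/-- The ambient two-dimensional submanifold without boundary. -/
def ambient (S : Surface n) : Set (MultiTime n) := ⋃ a, S.param a '' S.dom a

/-- The boundary of the surface: its points that are not interior to it, relative to the ambient
submanifold. -/
def boundary (S : Surface n) : Set (MultiTime n) :=
  {x | x ∈ S.carrier ∧ S.carrier ∉ 𝓝[S.ambient] x}

/-- The parameters in the domain of the `a`-th parametrization whose image lies on the surface and
in the image of no earlier parametrization. The images of these sets are a partition of the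
surface. -/
def piece (S : Surface n) (a : Fin S.N) : Set (ℝ × ℝ) :=
  {z | z ∈ S.dom a ∧ S.param a z ∈ S.carrier ∧
    ∀ b, b < a → S.param a z ∉ S.param b '' S.dom b}

/-- The integral over the surface of the 2-form `∑_{i<j} η_{ij} dx^i ∧ dx^j`. -/
def integral (S : Surface n) (η : Fin n → Fin n → MultiTime n → ℝ) : ℝ :=
  ∑ a, ∫ z in S.piece a,
    ∑ i, ∑ j ∈ Finset.Ioi i, η i j (S.param a z) * minor (S.param a) z i j

end Surface

/-- The action `∫_S ∑_{i<j} L_{ij}[u] dx^i ∧ dx^j`. -/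
def action (L : Fin n → Fin n → Jet2 n → ℝ) (S : Surface n) (u : MultiTime n → ℝ) : ℝ :=
  S.integral (fun i j => along u (L i j))

/-- The field `u` is a critical point of the action over the surface `S`, with respect to smooth
variations that vanish near the boundary of `S`. -/
def IsCriticalOn (L : Fin n → Fin n → Jet2 n → ℝ) (S : Surface n) (u : MultiTime n → ℝ) : Prop :=
  ∀ v : MultiTime n → ℝ, ContDiff ℝ ∞ v → Disjoint (tsupport v) S.boundary →
    HasDerivAt (fun ε : ℝ => action L S (fun x => u x + ε * v x)) 0 0

end PluriLagrangian

end

open scoped ContDiff Topology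

noncomputable section

namespace PluriLagrangian

variable {n : ℕ}

/-! ### Calculus on the jet space -/

/-! Along `u`, the first variation of each coefficient $L_{ij}$ is a linear second-order
differential operator applied to $v$, and its coefficients are the momenta of $L_{ij}$.
Differentiation under the integral (`hasDerivAt_action`) turns criticality on a surface into the
vanishing of the integral of the varied 2-form.

(B) implies (A). The Euler–Lagrange system is a parametrization of the momenta by functions $P_i$,
$Q_{ik}$ (`MultiTimeEL.exists_momentumPotential`). The cyclic equation makes the mixed momenta an
additive cocycle on the indices, hence a coboundary $Q_{ii}-Q_{jj}$; the independence equations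
define $P_i$ and the off-diagonal $Q_{ik}$. With $\Theta_i=-\bigl((P_i+D_iQ_{ii})v+\sum_k
Q_{ik}D_kv\bigr)$, the varied form is exactly $d\Theta$ (`MomentumPotential.variation_eq_extD`).
Since $\Theta$ is supported in the support of $v$, away from the boundary, Stokes' theorem
(`Surface.integral_extD_eq_zero`) gives zero. The boundary may be irregular, so Stokes is proved by
a partition of unity that reduces it to compactly supported forms in single charts.

(A) implies (B). Discs in affine planes suffice. Let $\ell$ be an affine function vanishing on the
plane and $w$ a bump function of the plane coordinates. Testing with $v=w\ell^2$, $w\ell$, $w$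
isolates in turn the normal second-order momenta, the first-order normal equation and the
Euler–Lagrange equation inside the plane. Coordinate planes give the equations `eq_u`, `eq_uk`,
`eq_ukm`. Planes spanned by $e_i+\alpha e_k$ and $e_j+\beta e_k$ relate the coefficients $L_{ij}$,
$L_{ik}$, $L_{kj}$ and give the remaining three. -/

theorem contDiff_pd {f : MultiTime n → ℝ} (hf : ContDiff ℝ ∞ f) (k : Fin n) :
    ContDiff ℝ ∞ (pd k f) :=
  (hf.fderiv_right (m := ∞) (by simp)).clm_apply contDiff_const

theorem pd_pd_comm {f : MultiTime n → ℝ} (hf : ContDiff ℝ ∞ f) (k m : Fin n) (x : MultiTime n) :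
    pd k (pd m f) x = pd m (pd k f) x := by
  have key : ∀ a b : Fin n, pd a (pd b f) x
      = fderiv ℝ (fderiv ℝ f) x (Pi.single a 1) (Pi.single b 1) := by
    intro a b
    have hd : DifferentiableAt ℝ (fderiv ℝ f) x :=
      (hf.fderiv_right (m := ∞) (by simp)).differentiable (by simp) x
    unfold pd
    rw [fderiv_clm_apply hd (differentiableAt_const _)]
    simp
  have hs : IsSymmSndFDerivAt ℝ f x :=
    hf.contDiffAt.isSymmSndFDerivAt (by
    rw [minSmoothness_of_isRCLikeNormedField]; exact ENat.LEInfty.out)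
  rw [key, key, hs]

theorem contDiff_jet2 {u : MultiTime n → ℝ} (hu : ContDiff ℝ ∞ u) : ContDiff ℝ ∞ (jet2 u) := by
  unfold jet2
  refine hu.prodMk (ContDiff.prodMk ?_ ?_)
  · exact contDiff_pi.2 fun k => contDiff_pd hu k
  · refine contDiff_pi.2 fun e => ?_
    induction e with
    | _ k m =>
      simp only [Sym2.lift_mk]
      exact ((contDiff_pd (contDiff_pd hu m) k).add (contDiff_pd (contDiff_pd hu k) m)).div_const 2

theorem contDiff_dU {f : Jet2 n → ℝ} (hf : ContDiff ℝ ∞ f) : ContDiff ℝ ∞ (dU f) :=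
  (hf.fderiv_right (m := ∞) (by simp)).clm_apply contDiff_const

theorem contDiff_dU1 {f : Jet2 n → ℝ} (hf : ContDiff ℝ ∞ f) (k : Fin n) :
    ContDiff ℝ ∞ (dU1 k f) :=
  (hf.fderiv_right (m := ∞) (by simp)).clm_apply contDiff_const

theorem contDiff_dU2 {f : Jet2 n → ℝ} (hf : ContDiff ℝ ∞ f) (k m : Fin n) :
    ContDiff ℝ ∞ (dU2 k m f) :=
  (hf.fderiv_right (m := ∞) (by simp)).clm_apply contDiff_const

theorem contDiff_along {u : MultiTime n → ℝ} (hu : ContDiff ℝ ∞ u) {f : Jet2 n → ℝ}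
    (hf : ContDiff ℝ ∞ f) : ContDiff ℝ ∞ (along u f) :=
  hf.comp (contDiff_jet2 hu)

theorem pd_add {f g : MultiTime n → ℝ} (hf : ContDiff ℝ ∞ f) (hg : ContDiff ℝ ∞ g) (k : Fin n)
    (x : MultiTime n) : pd k (fun y => f y + g y) x = pd k f x + pd k g x := by
  unfold pd
  rw [fderiv_fun_add (hf.differentiable (by simp) x) (hg.differentiable (by simp) x)]
  rfl

theorem pd_sub {f g : MultiTime n → ℝ} (hf : ContDiff ℝ ∞ f) (hg : ContDiff ℝ ∞ g) (k : Fin n)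
    (x : MultiTime n) : pd k (fun y => f y - g y) x = pd k f x - pd k g x := by
  unfold pd
  rw [fderiv_fun_sub (hf.differentiable (by simp) x) (hg.differentiable (by simp) x)]
  rfl

theorem pd_neg {f : MultiTime n → ℝ} (k : Fin n)
    (x : MultiTime n) : pd k (fun y => - f y) x = - pd k f x := by
  unfold pd
  rw [fderiv_fun_neg]
  rfl

theorem pd_const_mul {f : MultiTime n → ℝ} (hf : ContDiff ℝ ∞ f) (c : ℝ) (k : Fin n)
    (x : MultiTime n) : pd k (fun y => c * f y) x = c * pd k f x := by
  unfold pd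
  rw [fderiv_const_mul (hf.differentiable (by simp) x)]
  rfl

theorem pd_mul {f g : MultiTime n → ℝ} (hf : ContDiff ℝ ∞ f) (hg : ContDiff ℝ ∞ g) (k : Fin n)
    (x : MultiTime n) : pd k (fun y => f y * g y) x = pd k f x * g x + f x * pd k g x := by
  unfold pd
  rw [fderiv_fun_mul (hf.differentiable (by simp) x) (hg.differentiable (by simp) x)]
  simp
  ring

theorem pd_sum {ι : Type*} (s : Finset ι) {f : ι → MultiTime n → ℝ}
    (hf : ∀ a ∈ s, ContDiff ℝ ∞ (f a)) (k : Fin n)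
    (x : MultiTime n) : pd k (fun y => ∑ a ∈ s, f a y) x = ∑ a ∈ s, pd k (f a) x := by
  unfold pd
  rw [fderiv_fun_sum fun a ha => (hf a ha).differentiable (by simp) x]
  simp

theorem jet2_add_mul {u v : MultiTime n → ℝ} (hu : ContDiff ℝ ∞ u) (hv : ContDiff ℝ ∞ v) (ε : ℝ)
    (x : MultiTime n) : jet2 (fun y => u y + ε * v y) x = jet2 u x + ε • jet2 v x := by
  have h1 : ∀ k, pd k (fun y => u y + ε * v y) = fun y => pd k u y + ε * pd k v y := by
    intro k
    funext y
    rw [pd_add hu (contDiff_const.mul hv), pd_const_mul hv]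
  have h2 : ∀ k m, pd k (pd m (fun y => u y + ε * v y)) x
      = pd k (pd m u) x + ε * pd k (pd m v) x := by
    intro k m
    rw [h1, pd_add (contDiff_pd hu m) (contDiff_const.mul (contDiff_pd hv m)),
      pd_const_mul (contDiff_pd hv m)]
  refine Prod.ext (by simp [jet2]) (Prod.ext ?_ ?_)
  · funext k
    simp [jet2, h1]
  · funext e
    induction e with
    | _ k m =>
      simp only [jet2, Sym2.lift_mk, h2, Prod.snd_add, Prod.smul_snd, Pi.add_apply, Pi.smul_apply,
        smul_eq_mul]
      ring

/-- An off-diagonal unordered pair has two ordered representatives and a diagonal one has a single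
one, hence the weight one half off the diagonal. -/
theorem sum_sym2 {α : Type*} [Fintype α] [DecidableEq α] (g : Sym2 α → ℝ) :
    ∑ e, g e = ∑ k, ∑ m, if k = m then g s(k, m) else g s(k, m) / 2 := by
  rw [← Fintype.sum_prod_type' (f := fun k m => if k = m then g s(k, m) else g s(k, m) / 2),
    ← Finset.sum_fiberwise Finset.univ (fun p : α × α => s(p.1, p.2))]
  refine Finset.sum_congr rfl fun e _ => ?_
  induction e with
  | _ a b =>
    by_cases hab : a = b
    · subst hab
      have : (Finset.univ.filter fun p : α × α => s(p.1, p.2) = s(a, a)) = {(a, a)} := by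
        ext ⟨p, q⟩
        simp
      rw [this]
      simp
    · have : (Finset.univ.filter fun p : α × α => s(p.1, p.2) = s(a, b)) = {(a, b), (b, a)} := by
        ext ⟨p, q⟩
        simp
      rw [this, Finset.sum_pair (by simp [hab])]
      simp only [hab, if_false, Ne.symm hab, Sym2.eq_swap (a := b)]
      ring

/-- The component `(k, m)` of the symmetric tensor of second-order momenta: `∂f/∂u_{kk}` on the
diagonal, half of `∂f/∂u_{km}` off it. -/
def momentum2 (k m : Fin n) (f : Jet2 n → ℝ) (p : Jet2 n) : ℝ :=
  if k = m then dU2 k m f p else dU2 k m f p / 2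

theorem contDiff_momentum2 {f : Jet2 n → ℝ} (hf : ContDiff ℝ ∞ f) (k m : Fin n) :
    ContDiff ℝ ∞ (momentum2 k m f) := by
  unfold momentum2
  by_cases h : k = m
  · simpa [h] using contDiff_dU2 hf m m
  · simpa [h] using (contDiff_dU2 hf k m).div_const 2

theorem dU2_comm (k m : Fin n) (f : Jet2 n → ℝ) : dU2 k m f = dU2 m k f := by
  unfold dU2
  rw [Sym2.eq_swap]

theorem momentum2_comm (k m : Fin n) (f : Jet2 n → ℝ) : momentum2 k m f = momentum2 m k f := by
  unfold momentum2
  simp only [dU2_comm k m, eq_comm]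

/-- The first variation of `f[u]` in the direction `v`. -/
def variation (f : Jet2 n → ℝ) (u v : MultiTime n → ℝ) (x : MultiTime n) : ℝ :=
  fderiv ℝ f (jet2 u x) (jet2 v x)

/-- Expand the jet of `v` in the coordinate basis of the jet space. Passing to the symmetric tensor
`momentum2` makes the second-order part an unrestricted double sum, convenient for contraction with
covectors. -/
theorem variation_eq (f : Jet2 n → ℝ) (u : MultiTime n → ℝ) {v : MultiTime n → ℝ}
    (hv : ContDiff ℝ ∞ v) (x : MultiTime n) :
    variation f u v x = along u (dU f) x * v x + ∑ k, along u (dU1 k f) x * pd k v x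
      + ∑ k, ∑ m, along u (momentum2 k m f) x * pd k (pd m v) x := by
  have hsplit : jet2 v x = v x • ((1, 0, 0) : Jet2 n)
      + (∑ k, pd k v x • ((0, Pi.single k 1, 0) : Jet2 n))
      + ∑ e, (jet2 v x).2.2 e • ((0, 0, Pi.single e 1) : Jet2 n) := by
    refine Prod.ext ?_ (Prod.ext ?_ ?_)
    · simp [jet2, Prod.fst_sum]
    · funext k
      simp [jet2, Prod.fst_sum, Prod.snd_sum, Pi.single_apply]
    · funext e
      simp [Prod.snd_sum, Pi.single_apply]
  unfold variation
  rw [hsplit, map_add, map_add, map_smul, map_sum, map_sum, sum_sym2]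
  simp only [map_smul, smul_eq_mul]
  congr 1
  · congr 1
    · rw [mul_comm]; rfl
    · exact Finset.sum_congr rfl fun k _ => by rw [mul_comm]; rfl
  · refine Finset.sum_congr rfl fun k _ => Finset.sum_congr rfl fun m _ => ?_
    have : (jet2 v x).2.2 s(k, m) = pd k (pd m v) x := by
      simp only [jet2, Sym2.lift_mk]
      rw [pd_pd_comm hv m k]
      ring
    simp only [this, along, momentum2, dU2]
    split_ifs <;> ring

theorem contDiff_variation {f : Jet2 n → ℝ} (hf : ContDiff ℝ ∞ f) {u v : MultiTime n → ℝ}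
    (hu : ContDiff ℝ ∞ u) (hv : ContDiff ℝ ∞ v) : ContDiff ℝ ∞ (variation f u v) :=
  ((hf.fderiv_right (m := ∞) (by simp)).comp (contDiff_jet2 hu)).clm_apply (contDiff_jet2 hv)

theorem variation_neg (f : Jet2 n → ℝ) (u v : MultiTime n → ℝ) (x : MultiTime n) :
    variation (fun p => - f p) u v x = - variation f u v x := by
  simp [variation]

theorem hasDerivAt_along {f : Jet2 n → ℝ} (hf : ContDiff ℝ ∞ f) {u v : MultiTime n → ℝ}
    (hu : ContDiff ℝ ∞ u) (hv : ContDiff ℝ ∞ v) (x : MultiTime n) (ε : ℝ) :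
    HasDerivAt (fun ε : ℝ => along (fun y => u y + ε * v y) f x)
      (variation f (fun y => u y + ε * v y) v x) ε := by
  unfold along variation
  simp only [jet2_add_mul hu hv]
  have h := (hf.differentiable (by simp) (jet2 u x + ε • jet2 v x)).hasFDerivAt
  have h2 : HasDerivAt (fun ε : ℝ => jet2 u x + ε • jet2 v x) (jet2 v x) ε := by
    simpa using ((hasDerivAt_id ε).smul_const (jet2 v x)).const_add (jet2 u x)
  exact h.comp_hasDerivAt ε h2

/-! ### Transition maps and integrability on surfaces -/

open MeasureTheory Set

theorem det_prod_eq (A : ℝ × ℝ →L[ℝ] ℝ × ℝ) :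
    A.det = (A (1, 0)).1 * (A (0, 1)).2 - (A (0, 1)).1 * (A (1, 0)).2 := by
  rw [ContinuousLinearMap.det, ← LinearMap.det_toMatrix (Module.Basis.finTwoProd ℝ),
    Matrix.det_fin_two]
  simp [LinearMap.toMatrix_apply]

/-- Chain rule and multiplicativity of two-by-two determinants: reparametrization multiplies the
tangent bivector by the Jacobian. -/
theorem minor_comp {Γ Γ' : ℝ × ℝ → MultiTime n} {φ : ℝ × ℝ → ℝ × ℝ} {w : ℝ × ℝ}
    {φ' : ℝ × ℝ →L[ℝ] ℝ × ℝ} (hφ : HasFDerivAt φ φ' w) (hΓ : DifferentiableAt ℝ Γ (φ w))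
    (h : Γ ∘ φ =ᶠ[𝓝 w] Γ') (i j : Fin n) :
    minor Γ' w i j = φ'.det * minor Γ (φ w) i j := by
  have hd : fderiv ℝ Γ' w = (fderiv ℝ Γ (φ w)).comp φ' :=
    ((hΓ.hasFDerivAt.comp w hφ).congr_of_eventuallyEq h.symm).fderiv
  have hlin : ∀ p : ℝ × ℝ, ∀ k, fderiv ℝ Γ (φ w) p k
      = p.1 * fderiv ℝ Γ (φ w) (1, 0) k + p.2 * fderiv ℝ Γ (φ w) (0, 1) k := by
    intro p k
    have : p = p.1 • ((1 : ℝ), (0 : ℝ)) + p.2 • ((0 : ℝ), (1 : ℝ)) := by ext <;> simp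
    conv_lhs => rw [this, map_add, map_smul, map_smul]
    rfl
  unfold minor
  rw [hd, det_prod_eq]
  simp only [ContinuousLinearMap.comp_apply]
  rw [hlin (φ' (1, 0)) i, hlin (φ' (0, 1)) i, hlin (φ' (1, 0)) j, hlin (φ' (0, 1)) j]
  ring

theorem exists_minor_ne_zero {Γ : ℝ × ℝ → MultiTime n} {z : ℝ × ℝ}
    (h : Function.Injective (fderiv ℝ Γ z)) : ∃ i j, minor Γ z i j ≠ 0 := by
  by_contra! hc
  have hX : ∀ i, fderiv ℝ Γ z (1, 0) i = 0 := by
    intro i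
    -- If all minors vanish, this combination of the two tangent vectors has every component equal
    -- to a minor, up to sign; injectivity then kills its coefficients.
    have h0 : fderiv ℝ Γ z (-(fderiv ℝ Γ z (0, 1) i), fderiv ℝ Γ z (1, 0) i) = 0 := by
      have : ((-(fderiv ℝ Γ z (0, 1) i), fderiv ℝ Γ z (1, 0) i) : ℝ × ℝ)
          = (-(fderiv ℝ Γ z (0, 1) i)) • ((1 : ℝ), (0 : ℝ))
            + (fderiv ℝ Γ z (1, 0) i) • ((0 : ℝ), (1 : ℝ)) := by ext <;> simp
      rw [this, map_add, map_smul, map_smul]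
      funext j
      have := hc i j
      unfold minor at this
      simp only [Pi.add_apply, Pi.smul_apply, smul_eq_mul, Pi.zero_apply]
      linarith
    have := h (h0.trans (map_zero _).symm)
    exact congrArg Prod.snd this
  have : ((1 : ℝ), (0 : ℝ)) = 0 := h ((funext hX).trans (map_zero _).symm)
  simpa using congrArg Prod.fst this

theorem continuousOn_minor {Γ : ℝ × ℝ → MultiTime n} {U : Set (ℝ × ℝ)} (hU : IsOpen U)
    (hΓ : ContDiffOn ℝ ∞ Γ U) (i j : Fin n) : ContinuousOn (fun z => minor Γ z i j) U := by
  have hc : ContinuousOn (fderiv ℝ Γ) U := hΓ.continuousOn_fderiv_of_isOpen hU (by simp)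
  have h1 : ∀ (p : ℝ × ℝ) (k : Fin n), ContinuousOn (fun z => fderiv ℝ Γ z p k) U := fun p k =>
    (continuous_apply k).comp_continuousOn (hc.clm_apply continuousOn_const)
  exact ((h1 _ i).mul (h1 _ j)).sub ((h1 _ i).mul (h1 _ j))

namespace Surface

variable (S : Surface n)

theorem image_subset_ambient (a : Fin S.N) : S.param a '' S.dom a ⊆ S.ambient :=
  subset_iUnion (fun b => S.param b '' S.dom b) a

theorem param_mem_ambient {a : Fin S.N} {z : ℝ × ℝ} (hz : z ∈ S.dom a) :
    S.param a z ∈ S.ambient :=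
  S.image_subset_ambient a (mem_image_of_mem _ hz)

theorem continuousOn_param (a : Fin S.N) : ContinuousOn (S.param a) (S.dom a) :=
  (S.smooth a).continuousOn

theorem differentiableAt_param {a : Fin S.N} {z : ℝ × ℝ} (hz : z ∈ S.dom a) :
    DifferentiableAt ℝ (S.param a) z :=
  ((S.smooth a).contDiffAt ((S.isOpen_dom a).mem_nhds hz)).differentiableAt (by simp)

/-- The inverse of the `a`-th parametrization, on its image. -/
def coord (a : Fin S.N) : MultiTime n → ℝ × ℝ := Function.invFunOn (S.param a) (S.dom a)

theorem coord_mem {a : Fin S.N} {x : MultiTime n} (hx : x ∈ S.param a '' S.dom a) :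
    S.coord a x ∈ S.dom a :=
  Function.invFunOn_mem hx

theorem param_coord {a : Fin S.N} {x : MultiTime n} (hx : x ∈ S.param a '' S.dom a) :
    S.param a (S.coord a x) = x :=
  Function.invFunOn_eq hx

theorem coord_param {a : Fin S.N} {z : ℝ × ℝ} (hz : z ∈ S.dom a) :
    S.coord a (S.param a z) = z :=
  S.injOn a (S.coord_mem (mem_image_of_mem _ hz)) hz (S.param_coord (mem_image_of_mem _ hz))

/-- This is where embeddedness enters: parametrizations are open onto the ambient submanifold, so
their inverses are continuous on it. -/
theorem continuousWithinAt_coord {a : Fin S.N} {x : MultiTime n} (hx : x ∈ S.param a '' S.dom a) :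
    ContinuousWithinAt (S.coord a) S.ambient x := by
  rw [ContinuousWithinAt, Filter.tendsto_def]
  intro s hs
  obtain ⟨V, hVs, hV, hxV⟩ := mem_nhds_iff.1 hs
  obtain ⟨W, hW, hWeq⟩ := S.embedded a (V ∩ S.dom a) (hV.inter (S.isOpen_dom a)) inter_subset_right
  have hxW : x ∈ W := by
    have : x ∈ S.param a '' (V ∩ S.dom a) :=
      ⟨S.coord a x, ⟨hxV, S.coord_mem hx⟩, S.param_coord hx⟩
    rw [hWeq] at this
    exact this.1
  filter_upwards [mem_nhdsWithin_of_mem_nhds (hW.mem_nhds hxW), self_mem_nhdsWithin] with y hy hya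
  have : y ∈ S.param a '' (V ∩ S.dom a) := by
    rw [hWeq]
    exact ⟨hy, hya⟩
  obtain ⟨z, hz, rfl⟩ := this
  rw [mem_preimage, S.coord_param hz.2]
  exact hVs hz.1

/-- The domain of the transition map from the chart `b` to the chart `a`. -/
def overlap (b a : Fin S.N) : Set (ℝ × ℝ) := S.dom b ∩ S.param b ⁻¹' (S.param a '' S.dom a)

theorem isOpen_inter_preimage (b : Fin S.N) {W : Set (MultiTime n)} (hW : IsOpen W) :
    IsOpen (S.dom b ∩ S.param b ⁻¹' W) :=
  (S.continuousOn_param b).isOpen_inter_preimage (S.isOpen_dom b) hW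

theorem isOpen_overlap (b a : Fin S.N) : IsOpen (S.overlap b a) := by
  obtain ⟨W, hW, hWeq⟩ := S.embedded a _ (S.isOpen_dom a) subset_rfl
  have : S.overlap b a = S.dom b ∩ S.param b ⁻¹' W := by
    ext z
    simp only [overlap, hWeq, mem_inter_iff, mem_preimage]
    exact ⟨fun h => ⟨h.1, h.2.1⟩, fun h => ⟨h.1, h.2, S.param_mem_ambient h.1⟩⟩
  rw [this]
  exact S.isOpen_inter_preimage b hW

/-- The transition map from the chart `b` to the chart `a`. -/
def transition (b a : Fin S.N) (w : ℝ × ℝ) : ℝ × ℝ := S.coord a (S.param b w)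

theorem transition_mem {b a : Fin S.N} {w : ℝ × ℝ} (hw : w ∈ S.overlap b a) :
    S.transition b a w ∈ S.dom a :=
  S.coord_mem hw.2

theorem param_transition {b a : Fin S.N} {w : ℝ × ℝ} (hw : w ∈ S.overlap b a) :
    S.param a (S.transition b a w) = S.param b w :=
  S.param_coord hw.2

theorem injOn_transition (b a : Fin S.N) : InjOn (S.transition b a) (S.overlap b a) := by
  intro w hw w' hw' h
  refine S.injOn b hw.1 hw'.1 ?_
  rw [← S.param_transition hw, ← S.param_transition hw', h]

theorem param_comp_transition {b a : Fin S.N} {w : ℝ × ℝ} (hw : w ∈ S.overlap b a) :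
    S.param a ∘ S.transition b a =ᶠ[𝓝 w] S.param b := by
  filter_upwards [(S.isOpen_overlap b a).mem_nhds hw] with w' hw'
  exact S.param_transition hw'

/-- The transition map is a continuous solution $\varphi$ of $\Gamma_a\circ\varphi=\Gamma_b$.
Because the differential of $\Gamma_a$ has a linear left inverse, continuity already upgrades to
differentiability, with no appeal to the inverse function theorem. -/
theorem differentiableAt_transition {b a : Fin S.N} {w : ℝ × ℝ} (hw : w ∈ S.overlap b a) :
    DifferentiableAt ℝ (S.transition b a) w := by
  have hcont : ContinuousAt (S.transition b a) w := by
    refine (S.continuousWithinAt_coord hw.2).tendsto.comp ?_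
    refine tendsto_nhdsWithin_iff.2
      ⟨(S.continuousOn_param b).continuousAt ((S.isOpen_dom b).mem_nhds hw.1), ?_⟩
    filter_upwards [(S.isOpen_dom b).mem_nhds hw.1] with w' hw'
    exact S.param_mem_ambient hw'
  obtain ⟨Λ, hΛ⟩ := (fderiv ℝ (S.param a) (S.transition b a w)).toLinearMap
    |>.exists_leftInverse_of_injective (LinearMap.ker_eq_bot.2 (S.immersion a _ (S.transition_mem hw)))
  exact (HasFDerivAt.of_comp_of_leftInverse (f'symm := Λ.toContinuousLinearMap) hcont
    (S.differentiableAt_param (S.transition_mem hw)).hasFDerivAt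
    (S.differentiableAt_param hw.1).hasFDerivAt (S.param_comp_transition hw)
    (fun p => LinearMap.congr_fun hΛ p)).differentiableAt

theorem minor_eq_det_mul {b a : Fin S.N} {w : ℝ × ℝ} (hw : w ∈ S.overlap b a) (i j : Fin n) :
    minor (S.param b) w i j
      = (fderiv ℝ (S.transition b a) w).det * minor (S.param a) (S.transition b a w) i j :=
  minor_comp (S.differentiableAt_transition hw).hasFDerivAt
    (S.differentiableAt_param (S.transition_mem hw)) (S.param_comp_transition hw) i j

/-- Some minor is nonzero by immersivity, and comparing its two transformation rules identifies the
Jacobian with the positive factor supplied by `oriented`. -/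
theorem det_transition_pos {b a : Fin S.N} {w : ℝ × ℝ} (hw : w ∈ S.overlap b a) :
    0 < (fderiv ℝ (S.transition b a) w).det := by
  obtain ⟨i, j, hij⟩ := exists_minor_ne_zero (S.immersion a _ (S.transition_mem hw))
  obtain ⟨c, hc, hcm⟩ := S.oriented b a w hw.1 _ (S.transition_mem hw) (S.param_transition hw).symm
  have := (S.minor_eq_det_mul hw i j).symm.trans (hcm i j)
  rwa [mul_right_cancel₀ hij this]

/-- The parameters of the `a`-th chart whose image lies on the surface. -/
def region (a : Fin S.N) : Set (ℝ × ℝ) := S.dom a ∩ S.param a ⁻¹' S.carrier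

theorem piece_eq (a : Fin S.N) :
    S.piece a = S.region a \ ⋃ b, ⋃ _ : b < a, S.overlap a b := by
  ext z
  simp only [piece, region, overlap, mem_ofPred_eq, mem_sdiff, mem_inter_iff, mem_preimage,
    mem_iUnion, not_exists]
  tauto

theorem measurableSet_region (a : Fin S.N) : MeasurableSet (S.region a) := by
  have h : S.region a = S.dom a \ (S.dom a ∩ S.param a ⁻¹' S.carrierᶜ) := by
    ext z
    simp only [region, mem_inter_iff, mem_preimage, mem_sdiff, mem_compl_iff]
    tauto
  rw [h]
  exact (S.isOpen_dom a).measurableSet.diff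
    (S.isOpen_inter_preimage a S.isCompact_carrier.isClosed.isOpen_compl).measurableSet

theorem measurableSet_piece (a : Fin S.N) : MeasurableSet (S.piece a) := by
  rw [piece_eq]
  exact (S.measurableSet_region a).diff
    (MeasurableSet.iUnion fun b => MeasurableSet.iUnion fun _ =>
      (S.isOpen_overlap a b).measurableSet)

theorem piece_subset_region (a : Fin S.N) : S.piece a ⊆ S.region a := by
  rw [piece_eq]
  exact sdiff_subset

/-- The region need not be relatively compact in its chart domain, so the minors may be unbounded
there. Each point of the carrier, however, has a neighbourhood whose trace lies in a compact part of
some chart `b`, where the minors are bounded. The change of variables brings integrability back to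
chart `a`, and compactness of the carrier leaves finitely many such neighbourhoods. -/
theorem integrableOn_minor (a : Fin S.N) (i j : Fin n) :
    IntegrableOn (fun z => minor (S.param a) z i j) (S.region a) := by
  suffices h : IntegrableOn (fun z => minor (S.param a) z i j)
      (S.dom a ∩ S.param a ⁻¹' S.carrier) from h
  refine S.isCompact_carrier.induction_on
    (p := fun s => IntegrableOn (fun z => minor (S.param a) z i j) (S.dom a ∩ S.param a ⁻¹' s))
    (by simp) (fun s t hst ht => ht.mono_set ?_) (fun s t hs ht => ?_) (fun x hx => ?_)
  · exact inter_subset_inter_right _ (preimage_mono hst)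
  · rw [preimage_union, inter_union_distrib_left]
    exact hs.union ht
  · obtain ⟨b, hb⟩ := mem_iUnion.1 (S.carrier_subset hx)
    obtain ⟨z, hz, rfl⟩ := hb
    obtain ⟨B, hB, hzB, hBd⟩ := exists_compact_subset (S.isOpen_dom b) hz
    obtain ⟨W, hW, hWeq⟩ := S.embedded b (interior B) isOpen_interior (interior_subset.trans hBd)
    have hzW : S.param b z ∈ W := by
      have : S.param b z ∈ S.param b '' interior B := mem_image_of_mem _ hzB
      rw [hWeq] at this
      exact this.1
    refine ⟨W, mem_nhdsWithin_of_mem_nhds (hW.mem_nhds hzW), ?_⟩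
    set s := S.dom a ∩ S.param a ⁻¹' W with hs
    have hsW : ∀ w ∈ s, S.param a w ∈ S.param b '' interior B := by
      intro w hw
      rw [hWeq]
      exact ⟨hw.2, S.param_mem_ambient hw.1⟩
    have hso : s ⊆ S.overlap a b := by
      intro w hw
      exact ⟨hw.1, image_mono (interior_subset.trans hBd) (hsW w hw)⟩
    have him : S.transition a b '' s ⊆ B := by
      rintro _ ⟨w, hw, rfl⟩
      obtain ⟨z', hz', hzw⟩ := hsW w hw
      rw [transition, ← hzw, S.coord_param (hBd (interior_subset hz'))]
      exact interior_subset hz'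
    have hint : IntegrableOn (fun z => minor (S.param b) z i j) (S.transition a b '' s) :=
      (((continuousOn_minor (S.isOpen_dom b) (S.smooth b) i j).mono hBd).integrableOn_compact
        hB).mono_set him
    have hsm : MeasurableSet s := (S.isOpen_inter_preimage a hW).measurableSet
    rw [integrableOn_image_iff_integrableOn_abs_det_fderiv_smul volume hsm
      (fun w hw => (S.differentiableAt_transition (hso hw)).hasFDerivAt.hasFDerivWithinAt)
      ((S.injOn_transition a b).mono hso)] at hint
    refine hint.congr_fun (fun w hw => ?_) hsm
    dsimp only
    rw [abs_of_pos (S.det_transition_pos (hso hw)), smul_eq_mul, ← S.minor_eq_det_mul (hso hw)]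

theorem aestronglyMeasurable_param {a : Fin S.N} {s : Set (ℝ × ℝ)} (hs : MeasurableSet s)
    (hsd : s ⊆ S.dom a) {f : MultiTime n → ℝ} (hf : Continuous f) :
    AEStronglyMeasurable (fun z => f (S.param a z)) (volume.restrict s) :=
  (hf.comp_continuousOn ((S.continuousOn_param a).mono hsd)).aestronglyMeasurable hs

/-- The integrand of the surface integral of `∑_{i<j} η_{ij} dx^i ∧ dx^j` in the `a`-th chart. -/
def integrand (η : Fin n → Fin n → MultiTime n → ℝ) (a : Fin S.N) (z : ℝ × ℝ) : ℝ :=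
  ∑ i, ∑ j ∈ Finset.Ioi i, η i j (S.param a z) * minor (S.param a) z i j

theorem integral_eq (η : Fin n → Fin n → MultiTime n → ℝ) :
    S.integral η = ∑ a, ∫ z in S.piece a, S.integrand η a z := rfl

theorem integrableOn_mul_minor (a : Fin S.N) {f : MultiTime n → ℝ} (hf : Continuous f)
    (i j : Fin n) :
    IntegrableOn (fun z => f (S.param a z) * minor (S.param a) z i j) (S.region a) := by
  obtain ⟨C, hC⟩ := S.isCompact_carrier.exists_bound_of_continuousOn hf.continuousOn
  refine (S.integrableOn_minor a i j).bdd_mul (c := C)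
    (S.aestronglyMeasurable_param (S.measurableSet_region a) inter_subset_left hf) ?_
  exact (ae_restrict_iff' (S.measurableSet_region a)).2 (Filter.Eventually.of_forall
    fun z hz => hC _ hz.2)

theorem integrableOn_integrand {η : Fin n → Fin n → MultiTime n → ℝ}
    (hη : ∀ i j, Continuous (η i j)) (a : Fin S.N) :
    IntegrableOn (S.integrand η a) (S.region a) :=
  integrable_finsetSum _ fun i _ => integrable_finsetSum _ fun j _ =>
    S.integrableOn_mul_minor a (hη i j) i j

end Surface

/-! ### First variation of the action -/

theorem hasDerivAt_action {L : Fin n → Fin n → Jet2 n → ℝ} (hL : ∀ i j, ContDiff ℝ ∞ (L i j))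
    (S : Surface n) {u v : MultiTime n → ℝ} (hu : ContDiff ℝ ∞ u) (hv : ContDiff ℝ ∞ v) :
    HasDerivAt (fun ε : ℝ => action L S (fun x => u x + ε * v x))
      (S.integral fun i j => variation (L i j) u v) 0 := by
  have huv : ∀ ε : ℝ, ContDiff ℝ ∞ (fun x => u x + ε * v x) := fun ε =>
    hu.add (contDiff_const.mul hv)
  -- The dominating constants come from compactness of $[-1,1]$ times the carrier; multiplied by the
  -- integrable minors they bound the $\varepsilon$-derivative of the integrand.
  have hbound : ∀ i j, ∃ C, ∀ ε ∈ Icc (-1 : ℝ) 1, ∀ x ∈ S.carrier,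
      ‖variation (L i j) (fun x => u x + ε * v x) v x‖ ≤ C := by
    intro i j
    have hc : Continuous fun p : ℝ × MultiTime n =>
        variation (L i j) (fun x => u x + p.1 * v x) v p.2 := by
      unfold variation
      simp only [jet2_add_mul hu hv]
      have h1 : Continuous fun p : ℝ × MultiTime n => jet2 u p.2 + p.1 • jet2 v p.2 :=
        ((contDiff_jet2 hu).continuous.comp continuous_snd).add
          (continuous_fst.smul ((contDiff_jet2 hv).continuous.comp continuous_snd))
      exact (((hL i j).continuous_fderiv (by simp)).comp h1).clm_apply
        ((contDiff_jet2 hv).continuous.comp continuous_snd)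
    obtain ⟨C, hC⟩ := ((isCompact_Icc (a := (-1 : ℝ)) (b := 1)).prod
      S.isCompact_carrier).exists_bound_of_continuousOn hc.continuousOn
    exact ⟨C, fun ε hε x hx => hC (ε, x) ⟨hε, hx⟩⟩
  choose C hC using hbound
  unfold action
  simp only [S.integral_eq]
  refine HasDerivAt.fun_sum fun a _ => ?_
  have hae : ∀ {p : ℝ × ℝ → Prop}, (∀ z ∈ S.region a, p z) →
      ∀ᵐ z ∂(volume.restrict (S.piece a)), p z := fun h =>
    (ae_restrict_iff' (S.measurableSet_piece a)).2
      (Filter.Eventually.of_forall fun z hz => h z (S.piece_subset_region a hz))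
  have hint : ∀ {η : Fin n → Fin n → MultiTime n → ℝ}, (∀ i j, Continuous (η i j)) →
      IntegrableOn (S.integrand η a) (S.piece a) := fun hη =>
    (S.integrableOn_integrand hη a).mono_set (S.piece_subset_region a)
  have key := hasDerivAt_integral_of_dominated_loc_of_deriv_le
    (μ := volume.restrict (S.piece a)) (x₀ := (0 : ℝ)) (s := Icc (-1) 1)
    (F := fun ε => S.integrand (fun i j => along (fun x => u x + ε * v x) (L i j)) a)
    (F' := fun ε => S.integrand (fun i j => variation (L i j) (fun x => u x + ε * v x) v) a)
    (bound := fun z => ∑ i, ∑ j ∈ Finset.Ioi i, C i j * ‖minor (S.param a) z i j‖)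
    (Icc_mem_nhds (by norm_num) (by norm_num))
    (Filter.Eventually.of_forall fun ε =>
      (hint fun i j => (contDiff_along (huv ε) (hL i j)).continuous).aestronglyMeasurable)
    (hint fun i j => (contDiff_along (huv 0) (hL i j)).continuous)
    (hint fun i j => (contDiff_variation (hL i j) (huv 0) hv).continuous).aestronglyMeasurable
    (hae fun z hz ε hε => ?_)
    (integrable_finsetSum _ fun i _ => integrable_finsetSum _ fun j _ =>
      (((S.integrableOn_minor a i j).mono_set (S.piece_subset_region a)).norm.const_mul _))
    (hae fun z hz ε hε => ?_)
  · simpa using key.2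
  · refine (norm_sum_le _ _).trans (Finset.sum_le_sum fun i _ =>
      (norm_sum_le _ _).trans (Finset.sum_le_sum fun j _ => ?_))
    rw [norm_mul]
    exact mul_le_mul_of_nonneg_right (hC i j ε hε _ hz.2) (norm_nonneg _)
  · exact HasDerivAt.fun_sum fun i _ => HasDerivAt.fun_sum fun j _ =>
      (hasDerivAt_along (hL i j) hu hv _ ε).mul_const _

/-! ### Stokes' theorem -/

theorem sum_sum_Ioi_add (h : Fin n → Fin n → ℝ) (h0 : ∀ i, h i i = 0) :
    ∑ i, ∑ j ∈ Finset.Ioi i, (h i j + h j i) = ∑ i, ∑ j, h i j := by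
  have := Finset.sum_sum_Ioi_add_eq_sum_sum_off_diag (fun i j => h j i)
  rw [this]
  refine Finset.sum_congr rfl fun i _ => ?_
  refine Finset.sum_subset (Finset.subset_univ _) fun j _ hj => ?_
  have : j = i := by simpa using hj
  rw [this, h0]

/-- The coefficient of `dx^i ∧ dx^j` in the exterior derivative of `∑_k Θ_k dx^k`. -/
def extD (Θ : Fin n → MultiTime n → ℝ) (i j : Fin n) (x : MultiTime n) : ℝ :=
  pd i (Θ j) x - pd j (Θ i) x

theorem continuous_extD {Θ : Fin n → MultiTime n → ℝ} (hΘ : ∀ k, ContDiff ℝ ∞ (Θ k)) (i j : Fin n) :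
    Continuous (extD Θ i j) :=
  (contDiff_pd (hΘ j) i).continuous.sub (contDiff_pd (hΘ i) j).continuous

theorem extD_eq_zero {Θ : Fin n → MultiTime n → ℝ} {x : MultiTime n} (hx : ∀ k, x ∉ tsupport (Θ k))
    (i j : Fin n) : extD Θ i j x = 0 := by
  simp [extD, pd, fderiv_of_notMem_tsupport ℝ (hx _)]

theorem extD_sum {ι : Type*} (s : Finset ι) {Θ : ι → Fin n → MultiTime n → ℝ}
    (hΘ : ∀ a k, ContDiff ℝ ∞ (Θ a k)) (i j : Fin n) (x : MultiTime n) :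
    extD (fun k y => ∑ a ∈ s, Θ a k y) i j x = ∑ a ∈ s, extD (Θ a) i j x := by
  simp only [extD]
  rw [pd_sum s fun a _ => hΘ a j, pd_sum s fun a _ => hΘ a i, Finset.sum_sub_distrib]

/-- Integration by parts against the constant function 1. -/
theorem integral_fderiv_eq_zero {E : Type*} [NormedAddCommGroup E] [NormedSpace ℝ E]
    [FiniteDimensional ℝ E] [MeasurableSpace E] [BorelSpace E] {μ : Measure E} [μ.IsAddHaarMeasure]
    {F : E → ℝ} (hF : ContDiff ℝ 1 F)
    (hc : HasCompactSupport F) (p : E) : ∫ z, fderiv ℝ F z p ∂μ = 0 := by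
  have hi : Integrable (fun z => fderiv ℝ F z p) μ :=
    ((hF.continuous_fderiv (by simp)).clm_apply continuous_const).integrable_of_hasCompactSupport
      (hc.fderiv_apply ℝ p)
  have := integral_mul_fderiv_eq_neg_fderiv_mul_of_integrable (μ := μ) (f := fun _ : E => (1 : ℝ))
    (g := F) (v := p) (by simp) (by simpa using hi)
    (by simpa using hF.continuous.integrable_of_hasCompactSupport hc)
    (fun x _ => differentiableAt_const _) (fun x _ => hF.differentiable (by simp) x)
  simpa using this

/-- The pullback of the 1-form `∑_k Θ_k dx^k` along `Γ`, applied to the vector `p`. -/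
def pullback (Θ : Fin n → MultiTime n → ℝ) (Γ : ℝ × ℝ → MultiTime n) (p z : ℝ × ℝ) : ℝ :=
  ∑ k, Θ k (Γ z) * fderiv ℝ Γ z p k

theorem contDiffOn_pullback {Θ : Fin n → MultiTime n → ℝ} (hΘ : ∀ k, ContDiff ℝ ∞ (Θ k))
    {Γ : ℝ × ℝ → MultiTime n} {U : Set (ℝ × ℝ)} (hU : IsOpen U) (hΓ : ContDiffOn ℝ ∞ Γ U)
    (p : ℝ × ℝ) : ContDiffOn ℝ ∞ (pullback Θ Γ p) U := by
  have hd : ContDiffOn ℝ ∞ (fun z => fderiv ℝ Γ z p) U :=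
    (hΓ.fderiv_of_isOpen hU (m := ∞) (by simp)).clm_apply contDiffOn_const
  exact ContDiffOn.sum fun k _ => ((hΘ k).comp_contDiffOn hΓ).mul (contDiffOn_pi.1 hd k)

theorem fderiv_pullback {Θ : Fin n → MultiTime n → ℝ} (hΘ : ∀ k, ContDiff ℝ ∞ (Θ k))
    {Γ : ℝ × ℝ → MultiTime n} {z : ℝ × ℝ} (hΓ : ContDiffAt ℝ ∞ Γ z) (p q : ℝ × ℝ) :
    fderiv ℝ (pullback Θ Γ q) z p = ∑ k, ∑ l, pd l (Θ k) (Γ z) * fderiv ℝ Γ z p l * fderiv ℝ Γ z q k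
      + ∑ k, Θ k (Γ z) * fderiv ℝ (fderiv ℝ Γ) z p q k := by
  have hΓ1 : HasFDerivAt Γ (fderiv ℝ Γ z) z := (hΓ.differentiableAt (by simp)).hasFDerivAt
  have hΓ2 : HasFDerivAt (fderiv ℝ Γ) (fderiv ℝ (fderiv ℝ Γ) z) z :=
    ((hΓ.fderiv_right (m := ∞) (by simp)).differentiableAt (by simp)).hasFDerivAt
  have hlin : ∀ k (y : MultiTime n), fderiv ℝ (Θ k) (Γ z) y = ∑ l, pd l (Θ k) (Γ z) * y l := by
    intro k y
    conv_lhs => rw [pi_eq_sum_univ' y, map_sum]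
    refine Finset.sum_congr rfl fun l _ => ?_
    rw [map_smul, smul_eq_mul, mul_comm, pd]
  have hterm : ∀ k, HasFDerivAt (fun z => Θ k (Γ z) * fderiv ℝ Γ z q k)
      (Θ k (Γ z) • ((ContinuousLinearMap.proj k).comp
          ((ContinuousLinearMap.apply ℝ (MultiTime n) q).comp (fderiv ℝ (fderiv ℝ Γ) z)))
        + fderiv ℝ Γ z q k • (fderiv ℝ (Θ k) (Γ z)).comp (fderiv ℝ Γ z)) z := by
    intro k
    refine HasFDerivAt.mul ?_ ?_
    · exact ((hΘ k).differentiable (by simp) (Γ z)).hasFDerivAt.comp z hΓ1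
    · exact (ContinuousLinearMap.proj k).hasFDerivAt.comp z
        ((ContinuousLinearMap.apply ℝ (MultiTime n) q).hasFDerivAt.comp z hΓ2)
  have := (HasFDerivAt.fun_sum fun k (_ : k ∈ Finset.univ) => hterm k).fderiv
  unfold pullback
  rw [this]
  simp only [sum_apply, add_apply,
    smul_apply, ContinuousLinearMap.comp_apply, hlin, Finset.sum_add_distrib,
    ContinuousLinearMap.proj_apply, ContinuousLinearMap.apply_apply, smul_eq_mul, Finset.mul_sum]
  rw [add_comm]
  congr 1
  exact Finset.sum_congr rfl fun k _ => Finset.sum_congr rfl fun l _ => by ring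

/-- Exterior derivative commutes with pullback: the terms with second derivatives of `Γ` cancel by
their symmetry, and antisymmetrizing the rest produces the minors. -/
theorem sum_extD_mul_minor {Θ : Fin n → MultiTime n → ℝ} (hΘ : ∀ k, ContDiff ℝ ∞ (Θ k))
    {Γ : ℝ × ℝ → MultiTime n} {z : ℝ × ℝ} (hΓ : ContDiffAt ℝ ∞ Γ z) :
    ∑ i, ∑ j ∈ Finset.Ioi i, extD Θ i j (Γ z) * minor Γ z i j
      = fderiv ℝ (pullback Θ Γ (0, 1)) z (1, 0) - fderiv ℝ (pullback Θ Γ (1, 0)) z (0, 1) := by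
  have hs : IsSymmSndFDerivAt ℝ Γ z := hΓ.isSymmSndFDerivAt (by
    rw [minSmoothness_of_isRCLikeNormedField]; exact ENat.LEInfty.out)
  rw [fderiv_pullback hΘ hΓ, fderiv_pullback hΘ hΓ, hs (1, 0) (0, 1), add_sub_add_right_eq_sub,
    ← Finset.sum_sub_distrib]
  have h := sum_sum_Ioi_add (fun i j => pd j (Θ i) (Γ z) * minor Γ z j i)
    (fun i => by simp [minor, mul_comm])
  calc _ = ∑ i, ∑ j ∈ Finset.Ioi i, (pd j (Θ i) (Γ z) * minor Γ z j i
        + pd i (Θ j) (Γ z) * minor Γ z i j) := by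
        refine Finset.sum_congr rfl fun i _ => Finset.sum_congr rfl fun j _ => ?_
        unfold extD minor
        ring
    _ = _ := by
        rw [h]
        refine Finset.sum_congr rfl fun i _ => ?_
        rw [← Finset.sum_sub_distrib]
        refine Finset.sum_congr rfl fun j _ => ?_
        unfold minor
        ring

/-- The pulled-back 1-form vanishes off `K`, so its extension by zero is smooth and compactly
supported on the whole plane, where derivatives integrate to zero. -/
theorem setIntegral_extD_eq_zero {Θ : Fin n → MultiTime n → ℝ} (hΘ : ∀ k, ContDiff ℝ ∞ (Θ k))
    {Γ : ℝ × ℝ → MultiTime n} {U K : Set (ℝ × ℝ)} (hU : IsOpen U) (hΓ : ContDiffOn ℝ ∞ Γ U)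
    (hK : IsCompact K) (hKU : K ⊆ U) (hΘK : ∀ z ∈ U \ K, ∀ k, Θ k (Γ z) = 0) :
    ∫ z in U, ∑ i, ∑ j ∈ Finset.Ioi i, extD Θ i j (Γ z) * minor Γ z i j = 0 := by
  let G : ℝ × ℝ → ℝ × ℝ → ℝ := fun p => U.indicator (pullback Θ Γ p)
  have hG0 : ∀ p, ∀ z ∉ K, G p z = 0 := by
    intro p z hz
    by_cases hzU : z ∈ U
    · simp only [G, indicator_of_mem hzU, pullback]
      exact Finset.sum_eq_zero fun k _ => by rw [hΘK z ⟨hzU, hz⟩ k, zero_mul]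
    · exact indicator_of_notMem hzU _
  have hGU : ∀ p, ∀ z ∈ U, G p =ᶠ[𝓝 z] pullback Θ Γ p := fun p z hz => by
    filter_upwards [hU.mem_nhds hz] with y hy
    exact indicator_of_mem hy _
  have hG0' : ∀ p, ∀ z ∉ K, G p =ᶠ[𝓝 z] fun _ => 0 := fun p z hz => by
    filter_upwards [hK.isClosed.isOpen_compl.mem_nhds hz] with y hy
    exact hG0 p y hy
  have hG : ∀ p, ContDiff ℝ ∞ (G p) := by
    intro p
    rw [contDiff_iff_contDiffAt]
    intro z
    by_cases hzU : z ∈ U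
    · exact ((contDiffOn_pullback hΘ hU hΓ p).contDiffAt (hU.mem_nhds hzU)).congr_of_eventuallyEq
        (hGU p z hzU)
    · exact contDiffAt_const.congr_of_eventuallyEq (hG0' p z fun h => hzU (hKU h))
  have hGc : ∀ p, HasCompactSupport (G p) := fun p => HasCompactSupport.intro hK (hG0 p)
  have hGi : ∀ p q, Integrable (fun z => fderiv ℝ (G p) z q) := fun p q =>
    (((hG p).continuous_fderiv (by simp)).clm_apply
      continuous_const).integrable_of_hasCompactSupport ((hGc p).fderiv_apply ℝ q)
  calc _ = ∫ z in U, (fderiv ℝ (G (0, 1)) z (1, 0) - fderiv ℝ (G (1, 0)) z (0, 1)) := by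
        refine setIntegral_congr_fun hU.measurableSet fun z hz => ?_
        rw [(hGU (0, 1) z hz).fderiv_eq, (hGU (1, 0) z hz).fderiv_eq]
        exact sum_extD_mul_minor hΘ (hΓ.contDiffAt (hU.mem_nhds hz))
    _ = ∫ z, (fderiv ℝ (G (0, 1)) z (1, 0) - fderiv ℝ (G (1, 0)) z (0, 1)) := by
        refine setIntegral_eq_integral_of_forall_compl_eq_zero fun z hz => ?_
        rw [(hG0' (0, 1) z fun h => hz (hKU h)).fderiv_eq,
          (hG0' (1, 0) z fun h => hz (hKU h)).fderiv_eq]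
        simp
    _ = 0 := by
        rw [integral_sub (hGi _ _) (hGi _ _),
          integral_fderiv_eq_zero ((hG _).of_le (by simp)) (hGc _),
          integral_fderiv_eq_zero ((hG _).of_le (by simp)) (hGc _), sub_zero]

/-! ### From charts to surfaces: change of chart and partition of unity -/

namespace Surface

variable (S : Surface n)

theorem integral_sum {ι : Type*} (s : Finset ι) {η : ι → Fin n → Fin n → MultiTime n → ℝ}
    (hη : ∀ o i j, Continuous (η o i j)) :
    S.integral (fun i j x => ∑ o ∈ s, η o i j x) = ∑ o ∈ s, S.integral (η o) := by
  simp only [integral_eq]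
  rw [Finset.sum_comm]
  refine Finset.sum_congr rfl fun a _ => ?_
  rw [← integral_finsetSum s fun o _ =>
    (S.integrableOn_integrand (hη o) a).mono_set (S.piece_subset_region a)]
  congr 1
  funext z
  simp only [integrand, Finset.sum_mul]
  rw [Finset.sum_comm]
  refine Finset.sum_congr rfl fun i _ => ?_
  rw [Finset.sum_comm]

theorem integral_eq_zero_of_carrier {η : Fin n → Fin n → MultiTime n → ℝ}
    (hη : ∀ x ∈ S.carrier, ∀ i j, η i j x = 0) : S.integral η = 0 := by
  rw [integral_eq]
  refine Finset.sum_eq_zero fun a _ => setIntegral_eq_zero_of_forall_eq_zero fun z hz => ?_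
  exact Finset.sum_eq_zero fun i _ => Finset.sum_eq_zero fun j _ => by
    rw [hη _ hz.2.1, zero_mul]

/-- The part of `piece b` in the image of the chart `a`, in the coordinates of the chart `a`. -/
def pieceIn (a b : Fin S.N) : Set (ℝ × ℝ) := S.transition b a '' (S.piece b ∩ S.overlap b a)

theorem setIntegral_pieceIn (η : Fin n → Fin n → MultiTime n → ℝ) (a b : Fin S.N) :
    ∫ z in S.pieceIn a b, S.integrand η a z
      = ∫ z in S.piece b ∩ S.overlap b a, S.integrand η b z := by
  have hm : MeasurableSet (S.piece b ∩ S.overlap b a) :=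
    (S.measurableSet_piece b).inter (S.isOpen_overlap b a).measurableSet
  rw [pieceIn, integral_image_eq_integral_abs_det_fderiv_smul volume hm
    (fun w hw => (S.differentiableAt_transition hw.2).hasFDerivAt.hasFDerivWithinAt)
    ((S.injOn_transition b a).mono inter_subset_right)]
  refine setIntegral_congr_fun hm fun w hw => ?_
  rw [abs_of_pos (S.det_transition_pos hw.2), smul_eq_mul, integrand, integrand, Finset.mul_sum]
  refine Finset.sum_congr rfl fun i _ => ?_
  rw [Finset.mul_sum]
  refine Finset.sum_congr rfl fun j _ => ?_
  rw [S.param_transition hw.2, S.minor_eq_det_mul hw.2]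
  ring

theorem measurableSet_pieceIn (a b : Fin S.N) : MeasurableSet (S.pieceIn a b) :=
  measurable_image_of_fderivWithin
    ((S.measurableSet_piece b).inter (S.isOpen_overlap b a).measurableSet)
    (fun _ hw => (S.differentiableAt_transition hw.2).hasFDerivAt.hasFDerivWithinAt)
    ((S.injOn_transition b a).mono inter_subset_right)

theorem disjoint_pieceIn (a : Fin S.N) : Pairwise (Function.onFun Disjoint (S.pieceIn a)) := by
  have key : ∀ b c, b < c → Disjoint (S.pieceIn a b) (S.pieceIn a c) := by
    intro b c hbc
    rw [disjoint_left]
    rintro _ ⟨w, hw, rfl⟩ ⟨w', hw', h⟩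
    refine hw'.1.2.2 b hbc ⟨w, hw.1.1, ?_⟩
    rw [← S.param_transition hw.2, ← S.param_transition hw'.2, h]
  intro b c hbc
  rcases lt_or_gt_of_ne hbc with h | h
  · exact key b c h
  · exact (key c b h).symm

theorem iUnion_pieceIn (a : Fin S.N) : ⋃ b, S.pieceIn a b = S.region a := by
  ext z
  constructor
  · intro hz
    obtain ⟨b, w, hw, rfl⟩ := mem_iUnion.1 hz
    refine ⟨S.transition_mem hw.2, ?_⟩
    rw [mem_preimage, S.param_transition hw.2]
    exact hw.1.2.1
  · intro hz
    -- The piece containing a point is that of the first chart whose image contains it.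
    obtain ⟨b, hb, hmin⟩ := wellFounded_lt.has_min {b | S.param a z ∈ S.param b '' S.dom b}
      ⟨a, mem_image_of_mem _ hz.1⟩
    have hx := S.param_coord hb
    refine mem_iUnion.2 ⟨b, S.coord b (S.param a z),
      ⟨⟨S.coord_mem hb, ?_, ?_⟩, S.coord_mem hb, ?_⟩, ?_⟩
    · rw [hx]
      exact hz.2
    · intro c hc
      rw [hx]
      exact fun h => hmin c h hc
    · rw [mem_preimage, hx]
      exact mem_image_of_mem _ hz.1
    · rw [transition, hx, S.coord_param hz.1]

/-- The surface integral cuts the carrier into pieces according to the order of the charts.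
Transporting all pieces into chart `a` reassembles its region, so a form concentrated in one chart
can be integrated there alone. -/
theorem integral_eq_setIntegral_region {η : Fin n → Fin n → MultiTime n → ℝ}
    (hη : ∀ i j, Continuous (η i j)) (a : Fin S.N)
    (h0 : ∀ x ∈ S.carrier, x ∉ S.param a '' S.dom a → ∀ i j, η i j x = 0) :
    S.integral η = ∫ z in S.region a, S.integrand η a z := by
  rw [← S.iUnion_pieceIn a, integral_iUnion_fintype (S.measurableSet_pieceIn a)
    (S.disjoint_pieceIn a) fun b => (S.integrableOn_integrand hη a).mono_set
      ((subset_iUnion _ b).trans (S.iUnion_pieceIn a).subset), integral_eq]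
  refine Finset.sum_congr rfl fun b _ => ?_
  rw [S.setIntegral_pieceIn]
  refine setIntegral_eq_of_subset_of_forall_sdiff_eq_zero (S.measurableSet_piece b)
    inter_subset_left fun z hz => ?_
  have hz' : S.param b z ∉ S.param a '' S.dom a := fun h => hz.2 ⟨hz.1, hz.1.1, h⟩
  exact Finset.sum_eq_zero fun i _ => Finset.sum_eq_zero fun j _ => by
    rw [h0 _ hz.1.2.1 hz', zero_mul]

theorem exists_isOpen_inter_ambient_subset : ∃ G : Set (MultiTime n), IsOpen G ∧
    G ∩ S.ambient ⊆ S.carrier ∧ S.carrier \ S.boundary ⊆ G := by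
  refine ⟨⋃₀ {V | IsOpen V ∧ V ∩ S.ambient ⊆ S.carrier}, isOpen_sUnion fun V hV => hV.1, ?_, ?_⟩
  · rintro x ⟨⟨V, hV, hxV⟩, hx⟩
    exact hV.2 ⟨hxV, hx⟩
  · rintro x ⟨hx, hxb⟩
    have : S.carrier ∈ 𝓝[S.ambient] x := by
      by_contra h
      exact hxb ⟨hx, h⟩
    obtain ⟨V, hV, hxV, hVs⟩ := mem_nhdsWithin.1 this
    exact ⟨V, ⟨hV, hVs⟩, hxV⟩

/-- Stokes' theorem on a chart. -/
theorem integral_extD_eq_zero_of_chart {Θ : Fin n → MultiTime n → ℝ}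
    (hΘ : ∀ k, ContDiff ℝ ∞ (Θ k)) (a : Fin S.N) {C : Set (MultiTime n)} (hC : IsClosed C)
    (hΘC : ∀ k, tsupport (Θ k) ⊆ C) (hCS : C ∩ S.ambient ⊆ S.carrier)
    (hCa : C ∩ S.ambient ⊆ S.param a '' S.dom a) : S.integral (extD Θ) = 0 := by
  have h0 : ∀ x ∉ C, ∀ i j, extD Θ i j x = 0 := fun x hx i j =>
    extD_eq_zero (fun k hk => hx (hΘC k hk)) i j
  rw [S.integral_eq_setIntegral_region (continuous_extD hΘ) a fun x hx hxa =>
    h0 x fun hxC => hxa (hCa ⟨hxC, S.carrier_subset hx⟩)]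
  -- Points of the chart off the carrier lie outside `C` by `hCS`, so the irregular region may be
  -- replaced by the open chart domain.
  have hr : ∫ z in S.region a, S.integrand (extD Θ) a z
      = ∫ z in S.dom a, S.integrand (extD Θ) a z := by
    refine (setIntegral_eq_of_subset_of_forall_sdiff_eq_zero (S.isOpen_dom a).measurableSet
      inter_subset_left fun z hz => ?_).symm
    have : S.param a z ∉ C := fun h =>
      hz.2 ⟨hz.1, hCS ⟨h, S.param_mem_ambient hz.1⟩⟩
    exact Finset.sum_eq_zero fun i _ => Finset.sum_eq_zero fun j _ => by
      rw [h0 _ this, zero_mul]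
  rw [hr]
  -- The compact set for the planar statement is the coordinate image of `C ∩ S.carrier`.
  have hsub : C ∩ S.carrier ⊆ S.param a '' S.dom a := fun x hx =>
    hCa ⟨hx.1, S.carrier_subset hx.2⟩
  refine setIntegral_extD_eq_zero hΘ (K := S.coord a '' (C ∩ S.carrier)) (S.isOpen_dom a)
    (S.smooth a) ?_ ?_ ?_
  · refine (S.isCompact_carrier.inter_left hC).image_of_continuousOn fun x hx => ?_
    exact (S.continuousWithinAt_coord (hsub hx)).mono fun y hy => S.carrier_subset hy.2
  · rintro _ ⟨x, hx, rfl⟩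
    exact S.coord_mem (hsub hx)
  · intro z hz k
    by_contra h
    have hzC : S.param a z ∈ C := hΘC k (subset_tsupport _ h)
    exact hz.2 ⟨S.param a z, ⟨hzC, hCS ⟨hzC, S.param_mem_ambient hz.1⟩⟩, S.coord_param hz.1⟩

open scoped Manifold in
/-- Stokes' theorem for forms that vanish near the boundary. -/
theorem integral_extD_eq_zero {Θ : Fin n → MultiTime n → ℝ} (hΘ : ∀ k, ContDiff ℝ ∞ (Θ k))
    {C : Set (MultiTime n)} (hC : IsClosed C) (hΘC : ∀ k, tsupport (Θ k) ⊆ C)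
    (hCb : Disjoint C S.boundary) : S.integral (extD Θ) = 0 := by
  obtain ⟨G, hG, hGS, hSG⟩ := S.exists_isOpen_inter_ambient_subset
  have hW : ∀ a, ∃ W : Set (MultiTime n), IsOpen W ∧
      S.param a '' (S.dom a ∩ S.param a ⁻¹' G) = W ∩ S.ambient := fun a =>
    S.embedded a _ (S.isOpen_inter_preimage a hG) inter_subset_left
  choose W hWo hW using hW
  -- Each `W a` cuts out of the ambient submanifold the part of chart `a` that lies in `G`, hence
  -- inside the carrier. The extra index `none` covers the complement of `C ∩ S.carrier`; its share
  -- of the form has no support on the carrier.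
  let U : Option (Fin S.N) → Set (MultiTime n) := fun o => o.elim (C ∩ S.carrier)ᶜ W
  have hUo : ∀ o, IsOpen (U o) := by
    rintro (_ | a)
    · exact (hC.inter S.isCompact_carrier.isClosed).isOpen_compl
    · exact hWo a
  have hUc : (univ : Set (MultiTime n)) ⊆ ⋃ o, U o := by
    intro x _
    by_cases hx : x ∈ C ∩ S.carrier
    · have hxG : x ∈ G := hSG ⟨hx.2, disjoint_left.1 hCb hx.1⟩
      obtain ⟨a, z, hz, rfl⟩ := mem_iUnion.1 (S.carrier_subset hx.2)
      refine mem_iUnion.2 ⟨some a, ?_⟩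
      have : S.param a z ∈ W a ∩ S.ambient := by
        rw [← hW]
        exact ⟨z, ⟨hz, hxG⟩, rfl⟩
      exact this.1
    · exact mem_iUnion.2 ⟨none, hx⟩
  obtain ⟨ρ, hρ⟩ := SmoothPartitionOfUnity.exists_isSubordinate 𝓘(ℝ, MultiTime n) isClosed_univ U
    hUo hUc
  have hρs : ∀ o, ContDiff ℝ ∞ (ρ o) := fun o => (ρ o).contMDiff.contDiff
  have hρΘ : ∀ o k, ContDiff ℝ ∞ (fun x => ρ o x * Θ k x) := fun o k => (hρs o).mul (hΘ k)
  have hsum : Θ = fun k x => ∑ o, ρ o x * Θ k x := by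
    funext k x
    have := ρ.sum_eq_one (mem_univ x)
    rw [finsum_eq_sum_of_fintype] at this
    rw [← Finset.sum_mul, this, one_mul]
  have hext : extD Θ = fun i j x => ∑ o, extD (fun k x => ρ o x * Θ k x) i j x := by
    funext i j x
    conv_lhs => rw [hsum]
    exact extD_sum Finset.univ hρΘ i j x
  have hsupp : ∀ o k, tsupport (fun x => ρ o x * Θ k x) ⊆ tsupport (ρ o) ∩ C := fun o k =>
    subset_inter (tsupport_mul_subset_left (f := ρ o) (g := Θ k))
      ((tsupport_mul_subset_right (f := ρ o) (g := Θ k)).trans (hΘC k))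
  rw [hext, S.integral_sum _ fun o => continuous_extD (hρΘ o)]
  refine Finset.sum_eq_zero fun o _ => ?_
  rcases o with _ | a
  · refine S.integral_eq_zero_of_carrier fun x hx => extD_eq_zero fun k hk => ?_
    have := hsupp none k hk
    exact hρ none this.1 ⟨this.2, hx⟩
  · refine S.integral_extD_eq_zero_of_chart (hρΘ (some a)) a (C := tsupport (ρ (some a)) ∩ C)
      ((isClosed_tsupport _).inter hC) (hsupp (some a)) ?_ ?_
    · rintro x ⟨hx, hxa⟩
      have : x ∈ W a ∩ S.ambient := ⟨hρ (some a) hx.1, hxa⟩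
      rw [← hW] at this
      obtain ⟨z, hz, rfl⟩ := this
      exact hGS ⟨hz.2, hxa⟩
    · rintro x ⟨hx, hxa⟩
      have : x ∈ W a ∩ S.ambient := ⟨hρ (some a) hx.1, hxa⟩
      rw [← hW] at this
      exact image_mono inter_subset_left this

end Surface

/-! ### The multi-time Euler–Lagrange equations imply criticality -/

theorem dU1_skew {L : Fin n → Fin n → Jet2 n → ℝ} (hskew : ∀ i j p, L i j p = -L j i p)
    (i j k : Fin n) (p : Jet2 n) : dU1 k (L i j) p = - dU1 k (L j i) p := by
  have : L i j = fun p => - L j i p := funext (hskew i j)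
  rw [this]
  simp [dU1]

theorem dU2_skew {L : Fin n → Fin n → Jet2 n → ℝ} (hskew : ∀ i j p, L i j p = -L j i p)
    (i j k m : Fin n) (p : Jet2 n) : dU2 k m (L i j) p = - dU2 k m (L j i) p := by
  have : L i j = fun p => - L j i p := funext (hskew i j)
  rw [this]
  simp [dU2]

theorem var2_skew {L : Fin n → Fin n → Jet2 n → ℝ} (hskew : ∀ i j p, L i j p = -L j i p)
    (i j k m : Fin n) (u : MultiTime n → ℝ) (x : MultiTime n) :
    var2 k m (L i j) u x = - var2 k m (L j i) u x :=
  dU2_skew hskew i j k m _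

theorem var2_comm (k m : Fin n) (f : Jet2 n → ℝ) (u : MultiTime n → ℝ) (x : MultiTime n) :
    var2 k m f u x = var2 m k f u x := by
  unfold var2
  rw [dU2_comm]

theorem var1_skew {L : Fin n → Fin n → Jet2 n → ℝ} (hskew : ∀ i j p, L i j p = -L j i p)
    (i j k : Fin n) (u : MultiTime n → ℝ) (x : MultiTime n) :
    var1 i j k (L i j) u x = - var1 j i k (L j i) u x := by
  have h2 : ∀ m, along u (dU2 m k (L i j)) = fun x => - along u (dU2 m k (L j i)) x := fun m =>
    funext fun x => dU2_skew hskew i j m k _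
  unfold var1
  rw [h2, h2, pd_neg, pd_neg]
  simp only [along, dU1_skew hskew i j]
  ring

theorem contDiff_var2 {f : Jet2 n → ℝ} (hf : ContDiff ℝ ∞ f) {u : MultiTime n → ℝ}
    (hu : ContDiff ℝ ∞ u) (k m : Fin n) : ContDiff ℝ ∞ (var2 k m f u) :=
  contDiff_along hu (contDiff_dU2 hf k m)

theorem contDiff_var1 {f : Jet2 n → ℝ} (hf : ContDiff ℝ ∞ f) {u : MultiTime n → ℝ}
    (hu : ContDiff ℝ ∞ u) (i j k : Fin n) : ContDiff ℝ ∞ (var1 i j k f u) :=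
  ((contDiff_along hu (contDiff_dU1 hf k)).sub
    (contDiff_pd (contDiff_along hu (contDiff_dU2 hf i k)) i)).sub
    (contDiff_pd (contDiff_along hu (contDiff_dU2 hf j k)) j)

/-- The data `P`, `Q` through which the multi-time Euler–Lagrange equations express all momenta of
the coefficients `L_{ij}` along `u`. -/
structure MomentumPotential (L : Fin n → Fin n → Jet2 n → ℝ) (u : MultiTime n → ℝ)
    (P : Fin n → MultiTime n → ℝ) (Q : Fin n → Fin n → MultiTime n → ℝ) : Prop where
  contDiff_P : ∀ i, ContDiff ℝ ∞ (P i)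
  contDiff_Q : ∀ i k, ContDiff ℝ ∞ (Q i k)
  var1_eq : ∀ i j x, j ≠ i → var1 i j j (L i j) u x = P i x
  var2_eq : ∀ i j k x, k ≠ i → j ≠ i → var2 j k (L i j) u x = Q i k x
  var2_eq_sub : ∀ i j x, j ≠ i → var2 i j (L i j) u x = Q i i x - Q j j x

/-- The values $c_{ij}$ of `var2 i j (L i j) u` are antisymmetric and satisfy
$c_{ij}+c_{jk}+c_{ki}=0$, so $c_{ij}=r_i-r_j$. The functions $r_i$ become the diagonal of `Q`; `P`
and the off-diagonal part of `Q` are the common values in the two independence equations. -/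
theorem MultiTimeEL.exists_momentumPotential {L : Fin n → Fin n → Jet2 n → ℝ}
    (hL : ∀ i j, ContDiff ℝ ∞ (L i j)) (hskew : ∀ i j p, L i j p = -L j i p)
    {u : MultiTime n → ℝ} (hu : ContDiff ℝ ∞ u) (h : MultiTimeEL L u) :
    ∃ P Q, MomentumPotential L u P Q := by
  have hP : ∀ i, ∃ P : MultiTime n → ℝ, ContDiff ℝ ∞ P ∧
      ∀ j, j ≠ i → ∀ x, var1 i j j (L i j) u x = P x := by
    intro i
    by_cases hj : ∃ j, j ≠ i
    · obtain ⟨j, hj⟩ := hj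
      exact ⟨var1 i j j (L i j) u, contDiff_var1 (hL i j) hu i j j, fun j' hj' x =>
        h.indep_uj i j' j hj' hj x⟩
    · exact ⟨0, contDiff_const, fun j hj' => (hj ⟨j, hj'⟩).elim⟩
  have hr : ∃ r : Fin n → MultiTime n → ℝ, (∀ i, ContDiff ℝ ∞ (r i)) ∧
      ∀ i j, j ≠ i → ∀ x, var2 i j (L i j) u x = r i x - r j x := by
    rcases isEmpty_or_nonempty (Fin n) with he | ⟨⟨o⟩⟩
    · exact ⟨fun _ => 0, fun _ => contDiff_const, fun i => he.elim i⟩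
    -- Fix a base index `o` and take $r_i=c_{io}$, with $r_o=0$.
    · refine ⟨fun i => if i = o then 0 else var2 i o (L i o) u, fun i => ?_, fun i j hij x => ?_⟩
      · dsimp only
        split_ifs
        · exact contDiff_const
        · exact contDiff_var2 (hL i o) hu i o
      · by_cases hi : i = o
        · subst hi
          simp only [if_true, hij, if_false, Pi.zero_apply, zero_sub]
          rw [var2_skew hskew, var2_comm]
        · by_cases hj : j = o
          · subst hj
            simp [hi]
          · simp only [hi, hj, if_false]
            have h1 := h.cyclic i j o (Ne.symm hij) hj (Ne.symm hi) x
            have h2 := var2_skew hskew o i o i u x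
            rw [var2_comm o i (L i o)] at h2
            linarith
  choose P hPs hP using hP
  obtain ⟨r, hrs, hr⟩ := hr
  refine ⟨P, fun i k => if k = i then r i else var2 k k (L i k) u, hPs, fun i k => ?_,
    fun i j x hij => hP i j hij x, fun i j k x hk hj => ?_, fun i j x hij => ?_⟩
  · split_ifs
    · exact hrs i
    · exact contDiff_var2 (hL i k) hu k k
  · simp only [hk, if_false]
    exact h.indep_ujk i k j k hk hj hk x
  · simpa using hr i j hij x

/-! ### Momenta in terms of the potentials, and exactness of the first variation -/

namespace MomentumPotential

variable {L : Fin n → Fin n → Jet2 n → ℝ} {u : MultiTime n → ℝ} {P : Fin n → MultiTime n → ℝ}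
  {Q : Fin n → Fin n → MultiTime n → ℝ}

theorem along_dU2_snd (h : MomentumPotential L u P Q) {i j k : Fin n} (hk : k ≠ i) (hj : j ≠ i) :
    along u (dU2 j k (L i j)) = Q i k :=
  funext fun x => h.var2_eq i j k x hk hj

theorem along_dU2_fst (h : MomentumPotential L u P Q) (hskew : ∀ i j p, L i j p = -L j i p)
    {i j k : Fin n} (hk : k ≠ j) (hj : j ≠ i) :
    along u (dU2 i k (L i j)) = fun x => - Q j k x :=
  funext fun x => by
    rw [← h.var2_eq j i k x hk hj.symm, ← var2_skew hskew]
    rfl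

theorem along_dU2_mixed (h : MomentumPotential L u P Q) {i j : Fin n} (hj : j ≠ i) :
    along u (dU2 i j (L i j)) = fun x => Q i i x - Q j j x :=
  funext fun x => h.var2_eq_sub i j x hj

/-- The tensor of second-order momenta is the symmetrized product of $e_j$ with the row $Q_i$ minus
that of $e_i$ with the row $Q_j$. Off-diagonal entries of `Q` come from `indep_ujk`, the difference
$Q_{ii}-Q_{jj}$ in the mixed entry from `cyclic`, and the zeros from `eq_ukm`. -/
theorem momentum2_eq (h : MomentumPotential L u P Q) (hskew : ∀ i j p, L i j p = -L j i p)
    (hEL : MultiTimeEL L u) {i j : Fin n} (hj : j ≠ i) (k m : Fin n) (x : MultiTime n) :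
    along u (momentum2 k m (L i j)) x
      = ((if m = j then Q i k x else 0) + (if k = j then Q i m x else 0)
      - (if m = i then Q j k x else 0) - (if k = i then Q j m x else 0)) / 2 := by
  have e1 : ∀ k, k ≠ i → dU2 j k (L i j) (jet2 u x) = Q i k x := fun k hk =>
    h.var2_eq i j k x hk hj
  have e2 : ∀ k, k ≠ j → dU2 i k (L i j) (jet2 u x) = - Q j k x := fun k hk =>
    congrFun (h.along_dU2_fst hskew hk hj) x
  have e3 : dU2 i j (L i j) (jet2 u x) = Q i i x - Q j j x := h.var2_eq_sub i j x hj
  have e4 : ∀ k m, k ≠ i → k ≠ j → m ≠ i → m ≠ j → dU2 k m (L i j) (jet2 u x) = 0 :=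
    fun k m hki hkj hmi hmj => hEL.eq_ukm i j k m hj.symm hki hkj hmi hmj x
  unfold along momentum2
  by_cases hki : k = i
  · subst hki
    by_cases hmk : m = k
    · subst hmk
      simp only [if_true, hj.symm, if_false, e2 m hj.symm]
      ring
    · by_cases hmj : m = j
      · subst hmj
        simp only [if_true, hj, hj.symm, if_false, e3]
        ring
      · simp only [if_true, hj.symm, hmk, hmj, Ne.symm hmk, if_false, e2 m hmj]
        ring
  · by_cases hkj : k = j
    · subst hkj
      by_cases hmk : m = k
      · subst hmk
        simp only [if_true, hj, if_false, e1 m hj]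
        ring
      · by_cases hmi : m = i
        · subst hmi
          simp only [if_true, hmk, hj, if_false, dU2_comm k m, e3]
          ring
        · simp only [if_true, hmk, Ne.symm hmk, hmi, hj, if_false, e1 m hmi]
          ring
    · by_cases hmi : m = i
      · subst hmi
        simp only [if_true, hki, hkj, hj.symm, if_false, dU2_comm k m, e2 k hkj]
        ring
      · by_cases hmj : m = j
        · subst hmj
          simp only [if_true, hki, hkj, hj, if_false, dU2_comm k m, e1 k hki]
          ring
        · simp [hki, hkj, hmi, hmj, e4 k m hki hkj hmi hmj]

/-- Solve the definition of `var1` for the first-order momentum, with the second-order ones already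
known. The value of `var1` is $P_i$ for $k=j$, $-P_j$ for $k=i$, and zero otherwise. -/
theorem along_dU1 (h : MomentumPotential L u P Q) (hskew : ∀ i j p, L i j p = -L j i p)
    (hEL : MultiTimeEL L u) {i j : Fin n} (hj : j ≠ i) (k : Fin n) (x : MultiTime n) :
    along u (dU1 k (L i j)) x = pd j (Q i k) x - pd i (Q j k) x
      + (if k = j then P i x + pd i (Q i i) x else 0)
      - (if k = i then P j x + pd j (Q j j) x else 0) := by
  by_cases hkj : k = j
  · subst hkj
    have h1 := h.var1_eq i k x hj
    unfold var1 at h1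
    rw [h.along_dU2_mixed hj, h.along_dU2_snd hj hj,
      pd_sub (h.contDiff_Q _ _) (h.contDiff_Q _ _)] at h1
    simp only [if_true, hj, if_false]
    linarith
  · by_cases hki : k = i
    · subst hki
      have h1 := h.var1_eq j k x hj.symm
      rw [var1_skew hskew] at h1
      unfold var1 at h1
      rw [dU2_comm j k, h.along_dU2_mixed hj, h.along_dU2_fst hskew hj.symm hj, pd_neg,
        pd_sub (h.contDiff_Q _ _) (h.contDiff_Q _ _)] at h1
      simp only [if_true, hj.symm, if_false]
      linarith
    · have h1 := hEL.eq_uk i j k hj.symm hki hkj x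
      unfold var1 at h1
      rw [h.along_dU2_snd hki hj, h.along_dU2_fst hskew hkj hj, pd_neg] at h1
      simp only [hki, hkj, if_false]
      linarith

/-- In `eq_u` the second derivatives of the off-diagonal entries of `Q` cancel, and only the
combinations $P_i+D_iQ_{ii}$ survive. -/
theorem along_dU (h : MomentumPotential L u P Q) (hskew : ∀ i j p, L i j p = -L j i p)
    (hEL : MultiTimeEL L u) {i j : Fin n} (hj : j ≠ i) (x : MultiTime n) :
    along u (dU (L i j)) x = pd j (fun x => P i x + pd i (Q i i) x) x
      - pd i (fun x => P j x + pd j (Q j j) x) x := by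
  have hT : ∀ k, ContDiff ℝ ∞ (fun x => P k x + pd k (Q k k) x) := fun k =>
    (h.contDiff_P k).add (contDiff_pd (h.contDiff_Q k k) k)
  have hD : ∀ a b c, ContDiff ℝ ∞ (pd a (Q b c)) := fun a b c => contDiff_pd (h.contDiff_Q b c) a
  have hAi : along u (dU1 i (L i j)) = fun x => (pd j (Q i i) x - pd i (Q j i) x)
      - (fun x => P j x + pd j (Q j j) x) x := by
    funext x
    rw [h.along_dU1 hskew hEL hj]
    simp [hj.symm]
  have hAj : along u (dU1 j (L i j)) = fun x => (pd j (Q i j) x - pd i (Q j j) x)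
      + (fun x => P i x + pd i (Q i i) x) x := by
    funext x
    rw [h.along_dU1 hskew hEL hj]
    simp [hj]
  have h0 := hEL.eq_u i j hj.symm x
  unfold var0 at h0
  have hmix : pd j (along u (dU2 i j (L i j))) = fun x => pd j (Q i i) x - pd j (Q j j) x := by
    rw [h.along_dU2_mixed hj]
    exact funext fun x => pd_sub (h.contDiff_Q _ _) (h.contDiff_Q _ _) j x
  have hii : pd i (along u (dU2 i i (L i j))) = fun x => - pd i (Q j i) x := by
    rw [h.along_dU2_fst hskew hj.symm hj]
    exact funext fun x => pd_neg i x
  rw [hAi, hAj, hmix, hii, h.along_dU2_snd hj hj, pd_neg, pd_sub (hD _ _ _) (hD _ _ _),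
    pd_sub ((hD _ _ _).sub (hD _ _ _)) (hT j), pd_add ((hD _ _ _).sub (hD _ _ _)) (hT i),
    pd_sub (hD _ _ _) (hD _ _ _), pd_sub (hD _ _ _) (hD _ _ _),
    pd_pd_comm (h.contDiff_Q j j) j i] at h0
  linarith

/-- The 1-form whose exterior derivative is the first variation. -/
def primitive (P : Fin n → MultiTime n → ℝ) (Q : Fin n → Fin n → MultiTime n → ℝ)
    (v : MultiTime n → ℝ) (i : Fin n) (x : MultiTime n) : ℝ :=
  - ((P i x + pd i (Q i i) x) * v x + ∑ k, Q i k x * pd k v x)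

theorem contDiff_primitive (h : MomentumPotential L u P Q) {v : MultiTime n → ℝ}
    (hv : ContDiff ℝ ∞ v) (i : Fin n) : ContDiff ℝ ∞ (primitive P Q v i) :=
  ((((h.contDiff_P i).add (contDiff_pd (h.contDiff_Q i i) i)).mul hv).add
    (ContDiff.sum fun k _ => (h.contDiff_Q i k).mul (contDiff_pd hv k))).neg

theorem tsupport_primitive_subset (v : MultiTime n → ℝ) (i : Fin n) :
    tsupport (primitive P Q v i) ⊆ tsupport v := by
  refine closure_minimal (fun x hx => ?_) (isClosed_tsupport v)
  by_contra hxv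
  refine hx ?_
  simp [primitive, pd, fderiv_of_notMem_tsupport ℝ hxv, image_eq_zero_of_notMem_tsupport hxv]

theorem pd_primitive (h : MomentumPotential L u P Q) {v : MultiTime n → ℝ}
    (hv : ContDiff ℝ ∞ v) (i j : Fin n) (x : MultiTime n) :
    pd j (primitive P Q v i) x = - (pd j (fun x => P i x + pd i (Q i i) x) x * v x
      + (P i x + pd i (Q i i) x) * pd j v x
      + ∑ k, (pd j (Q i k) x * pd k v x + Q i k x * pd j (pd k v) x)) := by
  have hT : ContDiff ℝ ∞ (fun x => P i x + pd i (Q i i) x) :=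
    (h.contDiff_P i).add (contDiff_pd (h.contDiff_Q i i) i)
  have hQ : ∀ k, ContDiff ℝ ∞ (fun x => Q i k x * pd k v x) := fun k =>
    (h.contDiff_Q i k).mul (contDiff_pd hv k)
  unfold primitive
  rw [pd_neg, pd_add (hT.mul hv) (ContDiff.sum fun k _ => hQ k), pd_mul hT hv,
    pd_sum _ fun k _ => hQ k]
  simp only [pd_mul (h.contDiff_Q i _) (contDiff_pd hv _)]

/-- Both sides are linear differential operators in `v`; the three formulas for the momenta match
their coefficients order by order. -/
theorem variation_eq_extD (h : MomentumPotential L u P Q) (hskew : ∀ i j p, L i j p = -L j i p)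
    (hEL : MultiTimeEL L u) {v : MultiTime n → ℝ} (hv : ContDiff ℝ ∞ v) {i j : Fin n} (hj : j ≠ i)
    (x : MultiTime n) : variation (L i j) u v x = extD (primitive P Q v) i j x := by
  have h2 : ∑ k, ∑ m, along u (momentum2 k m (L i j)) x * pd k (pd m v) x
      = ∑ k, (Q i k x * pd j (pd k v) x - Q j k x * pd i (pd k v) x) := by
    -- Interchanging the partial derivatives makes the two halves of each symmetrized product
    -- coincide.
    have hc : ∀ k, pd k (pd j v) x = pd j (pd k v) x := fun k => pd_pd_comm hv k j x
    have hc' : ∀ k, pd k (pd i v) x = pd i (pd k v) x := fun k => pd_pd_comm hv k i x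
    simp only [h.momentum2_eq hskew hEL hj, sub_div, add_div, ite_div, zero_div, sub_mul, add_mul,
      ite_mul, zero_mul, Finset.sum_sub_distrib, Finset.sum_add_distrib, Finset.sum_ite_irrel,
      Finset.sum_ite_eq', Finset.mem_univ, if_true, Finset.sum_const_zero, hc, hc']
    simp only [← Finset.sum_add_distrib, ← Finset.sum_sub_distrib]
    exact Finset.sum_congr rfl fun k _ => by ring
  have h1 : ∑ k, along u (dU1 k (L i j)) x * pd k v x
      = ∑ k, (pd j (Q i k) x - pd i (Q j k) x) * pd k v x
        + (P i x + pd i (Q i i) x) * pd j v x - (P j x + pd j (Q j j) x) * pd i v x := by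
    simp only [h.along_dU1 hskew hEL hj, sub_mul, add_mul, ite_mul, zero_mul,
      Finset.sum_sub_distrib, Finset.sum_add_distrib, Finset.sum_ite_eq', Finset.mem_univ, if_true]
  rw [variation_eq _ _ hv, h2, h1, h.along_dU hskew hEL hj, extD, h.pd_primitive hv,
    h.pd_primitive hv]
  simp only [sub_mul, Finset.sum_sub_distrib, Finset.sum_add_distrib]
  ring

end MomentumPotential

theorem MultiTimeEL.isCriticalOn {L : Fin n → Fin n → Jet2 n → ℝ}
    (hL : ∀ i j, ContDiff ℝ ∞ (L i j)) (hskew : ∀ i j p, L i j p = -L j i p)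
    {u : MultiTime n → ℝ} (hu : ContDiff ℝ ∞ u) (h : MultiTimeEL L u) (S : Surface n) :
    IsCriticalOn L S u := by
  obtain ⟨P, Q, hPQ⟩ := h.exists_momentumPotential hL hskew hu
  intro v hv hvS
  have hd := hasDerivAt_action hL S hu hv
  have h0 : (S.integral fun i j => variation (L i j) u v)
      = S.integral (extD (MomentumPotential.primitive P Q v)) := by
    simp only [Surface.integral]
    refine Finset.sum_congr rfl fun a _ => congrArg _ (funext fun z => ?_)
    refine Finset.sum_congr rfl fun i _ => Finset.sum_congr rfl fun j hj => ?_
    rw [hPQ.variation_eq_extD hskew h hv (Finset.mem_Ioi.1 hj).ne']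
  rwa [h0, S.integral_extD_eq_zero (fun k => hPQ.contDiff_primitive hv k) (isClosed_tsupport v)
    (fun k => MomentumPotential.tsupport_primitive_subset v k) hvS] at hd

/-! ### Affine planes -/

/-- The vectors `a`, `b` span a plane on which `x^i`, `x^j` are the coordinates dual to them. -/
structure IsPlaneFrame (i j : Fin n) (a b : MultiTime n) : Prop where
  fst_fst : a i = 1
  fst_snd : a j = 0
  snd_fst : b i = 0
  snd_snd : b j = 1

/-- The affine parametrization of the plane through `x₀` spanned by `a` and `b`. -/
def planeMap (x₀ a b : MultiTime n) (z : ℝ × ℝ) : MultiTime n := x₀ + (z.1 • a + z.2 • b)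

/-- The coordinates `x^i`, `x^j`, relative to the point `x₀`. -/
def planeCoord (i j : Fin n) (x₀ x : MultiTime n) : ℝ × ℝ := (x i - x₀ i, x j - x₀ j)

theorem IsPlaneFrame.planeCoord_planeMap {i j : Fin n} {a b : MultiTime n}
    (h : IsPlaneFrame i j a b) (x₀ : MultiTime n) (z : ℝ × ℝ) :
    planeCoord i j x₀ (planeMap x₀ a b z) = z := by
  simp [planeCoord, planeMap, h.fst_fst, h.fst_snd, h.snd_fst, h.snd_snd]

theorem contDiff_planeMap (x₀ a b : MultiTime n) : ContDiff ℝ ∞ (planeMap x₀ a b) :=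
  contDiff_const.add ((contDiff_fst.smul contDiff_const).add (contDiff_snd.smul contDiff_const))

theorem contDiff_planeCoord (i j : Fin n) (x₀ : MultiTime n) :
    ContDiff ℝ ∞ (planeCoord i j x₀) :=
  ((contDiff_apply ℝ ℝ i).sub contDiff_const).prodMk ((contDiff_apply ℝ ℝ j).sub contDiff_const)

theorem hasFDerivAt_planeMap (x₀ a b : MultiTime n) (z : ℝ × ℝ) :
    HasFDerivAt (planeMap x₀ a b) ((ContinuousLinearMap.fst ℝ ℝ ℝ).smulRight a
      + (ContinuousLinearMap.snd ℝ ℝ ℝ).smulRight b) z :=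
  ((hasFDerivAt_fst.smul_const a).add (hasFDerivAt_snd.smul_const b)).const_add x₀

theorem fderiv_planeMap (x₀ a b : MultiTime n) (z p : ℝ × ℝ) :
    fderiv ℝ (planeMap x₀ a b) z p = p.1 • a + p.2 • b := by
  rw [(hasFDerivAt_planeMap x₀ a b z).fderiv]
  rfl

theorem minor_planeMap (x₀ a b : MultiTime n) (z : ℝ × ℝ) (i j : Fin n) :
    minor (planeMap x₀ a b) z i j = a i * b j - a j * b i := by
  simp only [minor, fderiv_planeMap]
  simp
  ring

/-- A disc in an affine plane. -/
def planeDisc {i j : Fin n} {a b : MultiTime n} (h : IsPlaneFrame i j a b) (x₀ : MultiTime n)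
    (R : ℝ) : Surface n where
  N := 1
  dom _ := univ
  param _ := planeMap x₀ a b
  isOpen_dom _ := isOpen_univ
  smooth _ := (contDiff_planeMap x₀ a b).contDiffOn
  injOn _ := (Function.LeftInverse.injective (h.planeCoord_planeMap x₀)).injOn
  immersion _ z _ := by
    intro p q hpq
    rw [fderiv_planeMap, fderiv_planeMap] at hpq
    have h1 := congrFun hpq i
    have h2 := congrFun hpq j
    simp only [Pi.add_apply, Pi.smul_apply, h.fst_fst, h.fst_snd, h.snd_fst, h.snd_snd,
      smul_eq_mul, mul_one, mul_zero, add_zero, zero_add] at h1 h2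
    exact Prod.ext h1 h2
  embedded _ V hV _ := by
    refine ⟨planeCoord i j x₀ ⁻¹' V, hV.preimage (contDiff_planeCoord i j x₀).continuous, ?_⟩
    ext x
    simp only [mem_image, mem_inter_iff, mem_preimage, mem_iUnion, mem_univ, true_and]
    constructor
    · rintro ⟨z, hz, rfl⟩
      exact ⟨by rwa [h.planeCoord_planeMap], 0, z, rfl⟩
    · rintro ⟨hx, _, z, rfl⟩
      exact ⟨z, by rwa [h.planeCoord_planeMap] at hx, rfl⟩
  oriented _ _ z _ w _ _ := ⟨1, one_pos, fun i j => by rw [minor_planeMap, minor_planeMap, one_mul]⟩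
  carrier := planeMap x₀ a b '' Metric.closedBall 0 R
  isCompact_carrier := (isCompact_closedBall 0 R).image (contDiff_planeMap x₀ a b).continuous
  carrier_subset := by
    rintro _ ⟨z, _, rfl⟩
    exact mem_iUnion.2 ⟨0, z, trivial, rfl⟩

theorem planeDisc_integral {i j : Fin n} {a b : MultiTime n} (h : IsPlaneFrame i j a b)
    (x₀ : MultiTime n) (R : ℝ) (η : Fin n → Fin n → MultiTime n → ℝ) :
    (planeDisc h x₀ R).integral η = ∫ z in Metric.closedBall 0 R,
      ∑ k, ∑ l ∈ Finset.Ioi k, η k l (planeMap x₀ a b z) * (a k * b l - a l * b k) := by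
  have hp : (planeDisc h x₀ R).piece (0 : Fin 1) = Metric.closedBall 0 R := by
    ext z
    constructor
    · rintro ⟨_, ⟨w, hw, hwz⟩, _⟩
      rwa [← Function.LeftInverse.injective (h.planeCoord_planeMap x₀) hwz]
    · intro hz
      exact ⟨trivial, ⟨z, hz, rfl⟩, fun c hc =>
        absurd (show c.val < 0 from hc) (Nat.not_lt_zero _)⟩
  have : (planeDisc h x₀ R).integral η = ∑ c : Fin 1, ∫ z in (planeDisc h x₀ R).piece c,
      ∑ k, ∑ l ∈ Finset.Ioi k, η k l (planeMap x₀ a b z) * minor (planeMap x₀ a b) z k l := rfl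
  rw [this, Fin.sum_univ_one, hp]
  simp only [minor_planeMap]

/-- On the plane the coordinates invert the parametrization, so a point of the disc with coordinates
in the open ball is interior to the disc. -/
theorem disjoint_boundary_planeDisc {i j : Fin n} {a b : MultiTime n} (h : IsPlaneFrame i j a b)
    (x₀ : MultiTime n) {R : ℝ} {C : Set (MultiTime n)}
    (hC : C ⊆ planeCoord i j x₀ ⁻¹' Metric.ball 0 R) :
    Disjoint C (planeDisc h x₀ R).boundary := by
  rw [disjoint_left]
  rintro x hxC ⟨_, hx⟩
  refine hx (mem_nhdsWithin.2 ⟨_, Metric.isOpen_ball.preimage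
    (contDiff_planeCoord i j x₀).continuous, hC hxC, ?_⟩)
  rintro y ⟨hy, hya⟩
  obtain ⟨_, z, _, rfl⟩ := mem_iUnion.1 hya
  refine ⟨z, Metric.ball_subset_closedBall ?_, rfl⟩
  have := h.planeCoord_planeMap x₀ z
  rw [← this]
  exact hy

theorem sum_Ioi_eq_sum_sum {L : Fin n → Fin n → ℝ} (hskew : ∀ i j, L i j = -L j i)
    (a b : MultiTime n) : ∑ k, ∑ l ∈ Finset.Ioi k, L k l * (a k * b l - a l * b k)
      = ∑ k, ∑ l, a k * b l * L k l := by
  rw [← sum_sum_Ioi_add (fun k l => a k * b l * L k l) fun i => ?_]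
  · refine Finset.sum_congr rfl fun k _ => Finset.sum_congr rfl fun l _ => ?_
    rw [hskew l k]
    ring
  · have : L i i = 0 := by linarith [hskew i i]
    rw [this, mul_zero]

theorem tsupport_pd_subset (k : Fin n) (v : MultiTime n → ℝ) : tsupport (pd k v) ⊆ tsupport v := by
  refine closure_minimal (fun x hx => ?_) (isClosed_tsupport v)
  by_contra hxv
  exact hx (by simp [pd, fderiv_of_notMem_tsupport ℝ hxv])

/-- The coefficient of the 2-form `∑_{i<j} L_{ij} dx^i ∧ dx^j` in the plane spanned by `a`, `b`. -/
def planeCoeff (L : Fin n → Fin n → Jet2 n → ℝ) (a b : MultiTime n) (p : Jet2 n) : ℝ :=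
  ∑ k, ∑ l, a k * b l * L k l p

theorem variation_planeCoeff {L : Fin n → Fin n → Jet2 n → ℝ} (hL : ∀ i j, ContDiff ℝ ∞ (L i j))
    (a b : MultiTime n) (u v : MultiTime n → ℝ) (x : MultiTime n) :
    variation (planeCoeff L a b) u v x = ∑ k, ∑ l, a k * b l * variation (L k l) u v x := by
  have hd : ∀ k l, HasFDerivAt (fun p => a k * b l * L k l p)
      ((a k * b l) • fderiv ℝ (L k l) (jet2 u x)) (jet2 u x) := fun k l =>
    ((hL k l).differentiable (by simp) _).hasFDerivAt.const_mul _
  have := (HasFDerivAt.fun_sum fun k (_ : k ∈ Finset.univ) =>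
    HasFDerivAt.fun_sum fun l (_ : l ∈ Finset.univ) => hd k l).fderiv
  unfold variation planeCoeff
  rw [this]
  simp [sum_apply]

/-- `u` is critical for the functional `∫ f[u]` on the plane through `x₀` spanned by `a`, `b`, with
respect to variations of compact support in the plane. -/
def IsPlaneCritical (f : Jet2 n → ℝ) (u : MultiTime n → ℝ) (i j : Fin n) (a b x₀ : MultiTime n) :
    Prop :=
  ∀ v : MultiTime n → ℝ, ContDiff ℝ ∞ v → ∀ K : Set (ℝ × ℝ), IsCompact K →
    tsupport v ⊆ planeCoord i j x₀ ⁻¹' K → ∫ z, variation f u v (planeMap x₀ a b z) = 0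

theorem isPlaneCritical_planeCoeff {L : Fin n → Fin n → Jet2 n → ℝ}
    (hL : ∀ i j, ContDiff ℝ ∞ (L i j)) (hskew : ∀ i j p, L i j p = -L j i p)
    {u : MultiTime n → ℝ} (hu : ContDiff ℝ ∞ u) (h : ∀ S : Surface n, IsCriticalOn L S u)
    {i j : Fin n} {a b : MultiTime n} (hab : IsPlaneFrame i j a b) (x₀ : MultiTime n) :
    IsPlaneCritical (planeCoeff L a b) u i j a b x₀ := by
  intro v hv K hK hvK
  -- The disc only has to contain the part of the support of `v` that meets the plane; `v` itself
  -- need not be compactly supported in multi-time.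
  obtain ⟨R, hR⟩ := hK.isBounded.subset_ball 0
  have h0 := (hasDerivAt_action hL (planeDisc hab x₀ R) hu hv).unique
    (h (planeDisc hab x₀ R) v hv (disjoint_boundary_planeDisc hab x₀
      (hvK.trans (preimage_mono hR))))
  have hsk : ∀ x k l, variation (L k l) u v x = - variation (L l k) u v x := by
    intro x k l
    rw [← variation_neg]
    congr 1
    exact funext (hskew k l)
  rw [planeDisc_integral] at h0
  simp only [sum_Ioi_eq_sum_sum (hsk _), ← variation_planeCoeff hL] at h0
  rw [← h0]
  refine (setIntegral_eq_integral_of_forall_compl_eq_zero fun z hz => ?_).symm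
  have hz' : planeMap x₀ a b z ∉ tsupport v := fun hzv => by
    have := hvK hzv
    rw [mem_preimage, hab.planeCoord_planeMap] at this
    exact hz (Metric.ball_subset_closedBall (hR this))
  rw [variation_eq _ _ hv]
  have h1 : ∀ k, pd k v (planeMap x₀ a b z) = 0 := fun k =>
    image_eq_zero_of_notMem_tsupport fun hk => hz' (tsupport_pd_subset k v hk)
  have h2 : ∀ k m, pd k (pd m v) (planeMap x₀ a b z) = 0 := fun k m =>
    image_eq_zero_of_notMem_tsupport fun hk =>
      hz' (tsupport_pd_subset m v (tsupport_pd_subset k _ hk))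
  simp [h1, h2, image_eq_zero_of_notMem_tsupport hz']

/-! ### Localization of the variation on a plane -/

theorem integral_mul_fderiv_eq_neg {g w : ℝ × ℝ → ℝ} (hg : ContDiff ℝ ∞ g) (hw : ContDiff ℝ ∞ w)
    (hc : HasCompactSupport w) (p : ℝ × ℝ) :
    ∫ z, g z * fderiv ℝ w z p = - ∫ z, fderiv ℝ g z p * w z := by
  have hg' : Continuous fun z => fderiv ℝ g z p :=
    (hg.continuous_fderiv (by simp)).clm_apply continuous_const
  have hw' : Continuous fun z => fderiv ℝ w z p :=
    (hw.continuous_fderiv (by simp)).clm_apply continuous_const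
  exact integral_mul_fderiv_eq_neg_fderiv_mul_of_integrable
    ((hg'.mul hw.continuous).integrable_of_hasCompactSupport hc.mul_left)
    ((hg.continuous.mul hw').integrable_of_hasCompactSupport (hc.fderiv_apply ℝ p).mul_left)
    ((hg.continuous.mul hw.continuous).integrable_of_hasCompactSupport hc.mul_left)
    (fun x _ => hg.differentiable (by simp) x) (fun x _ => hw.differentiable (by simp) x)

/-- Fundamental lemma of the calculus of variations: vanishing almost everywhere, then everywhere by
continuity. -/
theorem eq_zero_of_integral_mul_eq_zero {g : ℝ × ℝ → ℝ} (hg : Continuous g)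
    (h : ∀ w : ℝ × ℝ → ℝ, ContDiff ℝ ∞ w → HasCompactSupport w → ∫ z, g z * w z = 0)
    (z : ℝ × ℝ) : g z = 0 := by
  have hae : ∀ᵐ z, g z = 0 :=
    ae_eq_zero_of_integral_contDiff_smul_eq_zero hg.locallyIntegrable fun w hw hc => by
      simpa [mul_comm] using h w hw hc
  exact congrFun ((hg.ae_eq_iff_eq volume continuous_const).1 hae) z

theorem contDiff_fderiv_apply {w : ℝ × ℝ → ℝ} (hw : ContDiff ℝ ∞ w) (p : ℝ × ℝ) :
    ContDiff ℝ ∞ (fun z => fderiv ℝ w z p) :=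
  (hw.fderiv_right (m := ∞) (by simp)).clm_apply contDiff_const

theorem eq_zero_of_integral_first_order {g g₁ g₂ : ℝ × ℝ → ℝ} (hg : ContDiff ℝ ∞ g)
    (hg₁ : ContDiff ℝ ∞ g₁) (hg₂ : ContDiff ℝ ∞ g₂)
    (h : ∀ w : ℝ × ℝ → ℝ, ContDiff ℝ ∞ w → HasCompactSupport w →
      ∫ z, (g z * w z + g₁ z * fderiv ℝ w z (1, 0) + g₂ z * fderiv ℝ w z (0, 1)) = 0)
    (z : ℝ × ℝ) : g z - fderiv ℝ g₁ z (1, 0) - fderiv ℝ g₂ z (0, 1) = 0 := by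
  have h₁ := contDiff_fderiv_apply hg₁ (1, 0)
  have h₂ := contDiff_fderiv_apply hg₂ (0, 1)
  refine eq_zero_of_integral_mul_eq_zero (g := fun z => g z - fderiv ℝ g₁ z (1, 0)
    - fderiv ℝ g₂ z (0, 1)) ((hg.sub h₁).sub h₂).continuous (fun w hw hc => ?_) z
  have hi : ∀ {f : ℝ × ℝ → ℝ}, ContDiff ℝ ∞ f → Integrable (fun z => f z * w z) := fun hf =>
    (hf.continuous.mul hw.continuous).integrable_of_hasCompactSupport hc.mul_left
  have hi' : ∀ {f : ℝ × ℝ → ℝ} (p : ℝ × ℝ), ContDiff ℝ ∞ f →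
      Integrable (fun z => f z * fderiv ℝ w z p) := fun p hf =>
    (hf.continuous.mul (contDiff_fderiv_apply hw p).continuous).integrable_of_hasCompactSupport
      (hc.fderiv_apply ℝ p).mul_left
  have h0 := h w hw hc
  rw [integral_add ((hi hg).fun_add (hi' _ hg₁)) (hi' _ hg₂), integral_add (hi hg) (hi' _ hg₁),
    integral_mul_fderiv_eq_neg hg₁ hw hc, integral_mul_fderiv_eq_neg hg₂ hw hc] at h0
  simp only [sub_mul]
  rw [integral_sub ((hi hg).sub' (hi h₁)) (hi h₂), integral_sub (hi hg) (hi h₁)]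
  linarith

/-- One integration by parts in each second-order term reduces to the first-order statement. The
mixed term is integrated in the second variable and so joins the coefficient of the first
derivative. -/
theorem eq_zero_of_integral_second_order {g g₁ g₂ g₁₁ g₁₂ g₂₂ : ℝ × ℝ → ℝ} (hg : ContDiff ℝ ∞ g)
    (hg₁ : ContDiff ℝ ∞ g₁) (hg₂ : ContDiff ℝ ∞ g₂) (hg₁₁ : ContDiff ℝ ∞ g₁₁)
    (hg₁₂ : ContDiff ℝ ∞ g₁₂) (hg₂₂ : ContDiff ℝ ∞ g₂₂)
    (h : ∀ w : ℝ × ℝ → ℝ, ContDiff ℝ ∞ w → HasCompactSupport w →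
      ∫ z, (g z * w z + g₁ z * fderiv ℝ w z (1, 0) + g₂ z * fderiv ℝ w z (0, 1)
        + g₁₁ z * fderiv ℝ (fun z => fderiv ℝ w z (1, 0)) z (1, 0)
        + g₁₂ z * fderiv ℝ (fun z => fderiv ℝ w z (1, 0)) z (0, 1)
        + g₂₂ z * fderiv ℝ (fun z => fderiv ℝ w z (0, 1)) z (0, 1)) = 0)
    (z : ℝ × ℝ) : g z
      - fderiv ℝ (fun z => g₁ z - fderiv ℝ g₁₁ z (1, 0) - fderiv ℝ g₁₂ z (0, 1)) z (1, 0)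
      - fderiv ℝ (fun z => g₂ z - fderiv ℝ g₂₂ z (0, 1)) z (0, 1) = 0 := by
  have h₁₁ := contDiff_fderiv_apply hg₁₁ (1, 0)
  have h₁₂ := contDiff_fderiv_apply hg₁₂ (0, 1)
  have h₂₂ := contDiff_fderiv_apply hg₂₂ (0, 1)
  refine eq_zero_of_integral_first_order hg ((hg₁.sub h₁₁).sub h₁₂) (hg₂.sub h₂₂)
    (fun w hw hc => ?_) z
  have hi' : ∀ {f w : ℝ × ℝ → ℝ}, ContDiff ℝ ∞ f → ContDiff ℝ ∞ w → HasCompactSupport w →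
      Integrable (fun z => f z * w z) := fun hf hw hc =>
    (hf.continuous.mul hw.continuous).integrable_of_hasCompactSupport hc.mul_left
  have hw' := fun p => contDiff_fderiv_apply hw p
  have hc' : ∀ p, HasCompactSupport (fun z => fderiv ℝ w z p) := fun p => hc.fderiv_apply ℝ p
  have hw'' := fun p q => contDiff_fderiv_apply (hw' p) q
  have hc'' : ∀ p q, HasCompactSupport (fun z => fderiv ℝ (fun z => fderiv ℝ w z p) z q) :=
    fun p q => (hc' p).fderiv_apply ℝ q
  have i0 := hi' hg hw hc
  have i1 := hi' hg₁ (hw' (1, 0)) (hc' _)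
  have i2 := hi' hg₂ (hw' (0, 1)) (hc' _)
  have i11 := hi' hg₁₁ (hw'' (1, 0) (1, 0)) (hc'' _ _)
  have i12 := hi' hg₁₂ (hw'' (1, 0) (0, 1)) (hc'' _ _)
  have i22 := hi' hg₂₂ (hw'' (0, 1) (0, 1)) (hc'' _ _)
  have h0 := h w hw hc
  rw [integral_add ((((i0.fun_add i1).fun_add i2).fun_add i11).fun_add i12) i22,
    integral_add (((i0.fun_add i1).fun_add i2).fun_add i11) i12,
    integral_add ((i0.fun_add i1).fun_add i2) i11,
    integral_add (i0.fun_add i1) i2, integral_add i0 i1,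
    integral_mul_fderiv_eq_neg hg₁₁ (hw' _) (hc' _),
    integral_mul_fderiv_eq_neg hg₁₂ (hw' _) (hc' _),
    integral_mul_fderiv_eq_neg hg₂₂ (hw' _) (hc' _)] at h0
  have j11 := hi' h₁₁ (hw' (1, 0)) (hc' _)
  have j12 := hi' h₁₂ (hw' (1, 0)) (hc' _)
  have j22 := hi' h₂₂ (hw' (0, 1)) (hc' _)
  simp only [sub_mul]
  rw [integral_add (i0.fun_add ((i1.sub' j11).sub' j12)) (i2.sub' j22),
    integral_add i0 ((i1.sub' j11).sub' j12), integral_sub (i1.sub' j11) j12, integral_sub i1 j11,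
    integral_sub i2 j22]
  linarith

theorem fderiv_eq_sum_pd {f : MultiTime n → ℝ} (x y : MultiTime n) :
    fderiv ℝ f x y = ∑ l, y l * pd l f x := by
  conv_lhs => rw [pi_eq_sum_univ' y, map_sum]
  refine Finset.sum_congr rfl fun l _ => ?_
  rw [map_smul, smul_eq_mul, pd]

theorem fderiv_comp_planeMap {f : MultiTime n → ℝ} (hf : ContDiff ℝ ∞ f) (x₀ a b : MultiTime n)
    (z p : ℝ × ℝ) : fderiv ℝ (fun z => f (planeMap x₀ a b z)) z p
      = fderiv ℝ f (planeMap x₀ a b z) (p.1 • a + p.2 • b) := by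
  have := ((hf.differentiable (by simp) (planeMap x₀ a b z)).hasFDerivAt.comp z
    (hasFDerivAt_planeMap x₀ a b z)).fderiv
  exact congrArg (fun A : ℝ × ℝ →L[ℝ] ℝ => A p) this

theorem pd_comp_planeCoord {w : ℝ × ℝ → ℝ} (hw : ContDiff ℝ ∞ w) (i j k : Fin n)
    (x₀ x : MultiTime n) : pd k (fun x => w (planeCoord i j x₀ x)) x
      = (if k = i then fderiv ℝ w (planeCoord i j x₀ x) (1, 0) else 0)
        + (if k = j then fderiv ℝ w (planeCoord i j x₀ x) (0, 1) else 0) := by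
  have hpc : HasFDerivAt (planeCoord i j x₀) ((ContinuousLinearMap.proj (R := ℝ) i).prod
      (ContinuousLinearMap.proj (R := ℝ) (φ := fun _ : Fin n => ℝ) j)) x :=
    ((ContinuousLinearMap.proj (R := ℝ) (φ := fun _ : Fin n => ℝ) i).hasFDerivAt.sub_const _).prodMk
      ((ContinuousLinearMap.proj (R := ℝ) (φ := fun _ : Fin n => ℝ) j).hasFDerivAt.sub_const _)
  have := ((hw.differentiable (by simp) (planeCoord i j x₀ x)).hasFDerivAt.comp x hpc).fderiv
  have h2 : ((ContinuousLinearMap.proj (R := ℝ) i).prod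
      (ContinuousLinearMap.proj (R := ℝ) (φ := fun _ : Fin n => ℝ) j)) (Pi.single k 1)
      = (if k = i then (1 : ℝ) else 0) • ((1 : ℝ), (0 : ℝ))
        + (if k = j then (1 : ℝ) else 0) • ((0 : ℝ), (1 : ℝ)) := by
    by_cases hi : i = k <;> by_cases hj : j = k <;> ext <;>
      simp [hi, hj, eq_comm]
  unfold pd
  refine (congrArg (fun A : MultiTime n →L[ℝ] ℝ => A (Pi.single k 1)) this).trans ?_
  rw [ContinuousLinearMap.comp_apply, h2, map_add, map_smul, map_smul]
  simp

theorem tsupport_comp_planeCoord_mul_subset (w : ℝ × ℝ → ℝ) (ℓ : MultiTime n → ℝ) (i j : Fin n)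
    (x₀ : MultiTime n) : tsupport (fun x => w (planeCoord i j x₀ x) * ℓ x)
      ⊆ planeCoord i j x₀ ⁻¹' tsupport w := by
  refine closure_minimal (fun x hx => ?_)
    ((isClosed_tsupport w).preimage (contDiff_planeCoord i j x₀).continuous)
  exact subset_tsupport w fun h => hx (by simp [h])

/-- The linear function with gradient `ξ` that vanishes at `x₀`. -/
def linearForm (ξ : Fin n → ℝ) (x₀ x : MultiTime n) : ℝ := ∑ k, ξ k * (x k - x₀ k)

theorem contDiff_linearForm (ξ : Fin n → ℝ) (x₀ : MultiTime n) : ContDiff ℝ ∞ (linearForm ξ x₀) :=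
  ContDiff.sum fun k _ => contDiff_const.mul ((contDiff_apply ℝ ℝ k).sub contDiff_const)

theorem pd_linearForm (ξ : Fin n → ℝ) (x₀ : MultiTime n) (k : Fin n) (x : MultiTime n) :
    pd k (linearForm ξ x₀) x = ξ k := by
  have h : HasFDerivAt (linearForm ξ x₀)
      (∑ l, ξ l • ContinuousLinearMap.proj (R := ℝ) (φ := fun _ : Fin n => ℝ) l) x :=
    HasFDerivAt.fun_sum fun l _ => ((ContinuousLinearMap.proj (R := ℝ)
      (φ := fun _ : Fin n => ℝ) l).hasFDerivAt.sub_const (x₀ l)).const_mul (ξ l)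
  rw [pd, h.fderiv]
  simp [sum_apply, Pi.single_apply]

theorem linearForm_planeMap {ξ a b : Fin n → ℝ} (ha : ∑ k, ξ k * a k = 0) (hb : ∑ k, ξ k * b k = 0)
    (x₀ : MultiTime n) (z : ℝ × ℝ) : linearForm ξ x₀ (planeMap x₀ a b z) = 0 := by
  have : linearForm ξ x₀ (planeMap x₀ a b z)
      = z.1 * ∑ k, ξ k * a k + z.2 * ∑ k, ξ k * b k := by
    simp only [linearForm, planeMap, Pi.add_apply, Pi.smul_apply, smul_eq_mul, Finset.mul_sum,
      ← Finset.sum_add_distrib]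
    exact Finset.sum_congr rfl fun k _ => by ring
  rw [this, ha, hb]
  ring

/-! ### Test functions vanishing to order two, one and zero on a plane -/

namespace IsPlaneCritical

variable {f : Jet2 n → ℝ} {u : MultiTime n → ℝ} {i j : Fin n} {a b x₀ : MultiTime n}

/-- Test with $v=w\ell^2$, where $\ell$ has gradient `ξ` and vanishes on the plane. There $v$ and
its first derivatives vanish and $D_kD_mv=2w\,\xi_k\xi_m$, so only the second-order momenta
contribute. -/
theorem sum_momentum2_eq_zero (h : IsPlaneCritical f u i j a b x₀) (hab : IsPlaneFrame i j a b)
    (hf : ContDiff ℝ ∞ f) (hu : ContDiff ℝ ∞ u) {ξ : Fin n → ℝ} (ha : ∑ k, ξ k * a k = 0)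
    (hb : ∑ k, ξ k * b k = 0) :
    ∑ k, ∑ m, along u (momentum2 k m f) x₀ * (ξ k * ξ m) = 0 := by
  have hg : ContDiff ℝ ∞ (fun x => ∑ k, ∑ m, along u (momentum2 k m f) x * (ξ k * ξ m)) :=
    ContDiff.sum fun k _ => ContDiff.sum fun m _ =>
      (contDiff_along hu (contDiff_momentum2 hf k m)).mul contDiff_const
  have key := eq_zero_of_integral_mul_eq_zero
    (hg.comp (contDiff_planeMap x₀ a b)).continuous (fun w hw hc => ?_) 0
  · simpa [planeMap] using key
  have hW : ContDiff ℝ ∞ fun x => w (planeCoord i j x₀ x) :=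
    hw.comp (contDiff_planeCoord i j x₀)
  have hl := contDiff_linearForm ξ x₀
  have h0 := h (fun x => w (planeCoord i j x₀ x) * (linearForm ξ x₀ x * linearForm ξ x₀ x))
    (hW.mul (hl.mul hl)) _ hc (tsupport_comp_planeCoord_mul_subset _ _ _ _ _)
  have hpd : ∀ m, pd m (fun x => w (planeCoord i j x₀ x) * (linearForm ξ x₀ x * linearForm ξ x₀ x))
      = fun x => (pd m (fun x => w (planeCoord i j x₀ x)) x * linearForm ξ x₀ x
        + (2 * ξ m) * w (planeCoord i j x₀ x)) * linearForm ξ x₀ x := by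
    intro m
    funext x
    rw [pd_mul hW (hl.mul hl), pd_mul hl hl, pd_linearForm]
    ring
  have hval : ∀ z, variation f u
      (fun x => w (planeCoord i j x₀ x) * (linearForm ξ x₀ x * linearForm ξ x₀ x))
      (planeMap x₀ a b z) = 2 * (((fun x => ∑ k, ∑ m, along u (momentum2 k m f) x * (ξ k * ξ m)) ∘
        planeMap x₀ a b) z * w z) := by
    intro z
    have hl0 := linearForm_planeMap ha hb x₀ z
    rw [variation_eq _ _ (hW.mul (hl.mul hl))]
    simp only [hpd]
    have hpd2 : ∀ k m, pd k (fun x => (pd m (fun x => w (planeCoord i j x₀ x)) x * linearForm ξ x₀ x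
        + (2 * ξ m) * w (planeCoord i j x₀ x)) * linearForm ξ x₀ x) (planeMap x₀ a b z)
        = 2 * ξ m * w z * ξ k := by
      intro k m
      rw [pd_mul (((contDiff_pd hW m).mul hl).add (contDiff_const.mul hW)) hl, pd_linearForm, hl0,
        hab.planeCoord_planeMap]
      ring
    simp only [hpd2, hl0, mul_zero, Finset.sum_const_zero, zero_add, Function.comp_apply,
      Finset.mul_sum, Finset.sum_mul]
    exact Finset.sum_congr rfl fun k _ => Finset.sum_congr rfl fun m _ => by ring
  simp only [hval] at h0
  rw [integral_const_mul] at h0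
  linarith

/-- Test with $v=w\ell$: on the plane $v=0$, $D_kv=w\xi_k$ and $D_kD_mv=\xi_mD_kw+\xi_kD_mw$.
Symmetry of the momenta gives the factor 2. Since $w$ depends on $x^i,x^j$ alone, only these two
derivatives of $w$ occur, and integrating them by parts in the plane differentiates along `a` and
`b`. -/
theorem first_order (h : IsPlaneCritical f u i j a b x₀) (hab : IsPlaneFrame i j a b)
    (hf : ContDiff ℝ ∞ f) (hu : ContDiff ℝ ∞ u) {ξ : Fin n → ℝ} (ha : ∑ k, ξ k * a k = 0)
    (hb : ∑ k, ξ k * b k = 0) :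
    ∑ k, along u (dU1 k f) x₀ * ξ k
      - fderiv ℝ (fun x => ∑ m, 2 * along u (momentum2 i m f) x * ξ m) x₀ a
      - fderiv ℝ (fun x => ∑ m, 2 * along u (momentum2 j m f) x * ξ m) x₀ b = 0 := by
  have hM : ∀ k m, ContDiff ℝ ∞ (along u (momentum2 k m f)) := fun k m =>
    contDiff_along hu (contDiff_momentum2 hf k m)
  have hg : ContDiff ℝ ∞ (fun x => ∑ k, along u (dU1 k f) x * ξ k) :=
    ContDiff.sum fun k _ => (contDiff_along hu (contDiff_dU1 hf k)).mul contDiff_const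
  have hgi : ∀ i, ContDiff ℝ ∞ (fun x => ∑ m, 2 * along u (momentum2 i m f) x * ξ m) := fun i =>
    ContDiff.sum fun m _ => (contDiff_const.mul (hM i m)).mul contDiff_const
  have hΓ := contDiff_planeMap x₀ a b
  have key := eq_zero_of_integral_first_order (hg.comp hΓ) ((hgi i).comp hΓ) ((hgi j).comp hΓ)
    (fun w hw hc => ?_) 0
  · simp only [Function.comp_def] at key
    rw [fderiv_comp_planeMap (hgi i), fderiv_comp_planeMap (hgi j)] at key
    simpa [planeMap] using key
  have hW : ContDiff ℝ ∞ fun x => w (planeCoord i j x₀ x) :=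
    hw.comp (contDiff_planeCoord i j x₀)
  have hl := contDiff_linearForm ξ x₀
  refine Eq.trans ?_ (h (fun x => w (planeCoord i j x₀ x) * linearForm ξ x₀ x)
    (hW.mul hl) _ hc (tsupport_comp_planeCoord_mul_subset _ _ _ _ _))
  congr 1
  funext z
  have hl0 := linearForm_planeMap ha hb x₀ z
  have hpd : ∀ m, pd m (fun x => w (planeCoord i j x₀ x) * linearForm ξ x₀ x)
      = fun x => pd m (fun x => w (planeCoord i j x₀ x)) x * linearForm ξ x₀ x
        + w (planeCoord i j x₀ x) * ξ m := by
    intro m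
    funext x
    rw [pd_mul hW hl, pd_linearForm]
  have hpd2 : ∀ k m, pd k (fun x => pd m (fun x => w (planeCoord i j x₀ x)) x * linearForm ξ x₀ x
        + w (planeCoord i j x₀ x) * ξ m) (planeMap x₀ a b z)
      = ((if m = i then fderiv ℝ w z (1, 0) else 0) + (if m = j then fderiv ℝ w z (0, 1) else 0))
          * ξ k
        + ((if k = i then fderiv ℝ w z (1, 0) else 0) + (if k = j then fderiv ℝ w z (0, 1) else 0))
          * ξ m := by
    intro k m
    have hξ : ContDiff ℝ ∞ (fun _ : MultiTime n => ξ m) := contDiff_const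
    rw [pd_add ((contDiff_pd hW m).mul hl) (hW.mul hξ), pd_mul (contDiff_pd hW m) hl,
      pd_mul hW hξ, pd_linearForm, hl0, pd_comp_planeCoord hw, pd_comp_planeCoord hw,
      hab.planeCoord_planeMap]
    simp [pd]
  rw [variation_eq _ _ (hW.mul hl)]
  simp only [hpd, hpd2, hl0, hab.planeCoord_planeMap, mul_zero, zero_add, Function.comp_apply]
  have hsw : ∀ c : Fin n → ℝ, ∑ k, ∑ m, along u (momentum2 k m f) (planeMap x₀ a b z) * (c m * ξ k)
      = ∑ k, ∑ m, along u (momentum2 k m f) (planeMap x₀ a b z) * (c k * ξ m) := by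
    intro c
    rw [Finset.sum_comm]
    simp only [momentum2_comm]
  simp only [mul_add (along u _ _), Finset.sum_add_distrib]
  rw [hsw fun m => (if m = i then fderiv ℝ w z (1, 0) else 0)
    + (if m = j then fderiv ℝ w z (0, 1) else 0)]
  simp only [add_mul, mul_add, ite_mul, mul_ite, zero_mul, mul_zero, Finset.sum_add_distrib,
    Finset.sum_ite_irrel, Finset.sum_const_zero, Finset.sum_ite_eq', Finset.mem_univ, if_true]
  simp only [Finset.sum_mul, ← Finset.sum_add_distrib]
  exact Finset.sum_congr rfl fun m _ => by ring

/-- Test with $v=w$ itself. On a coordinate plane the derivatives along the frame are $D_i$ and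
$D_j$, so the planar Euler–Lagrange expression is `var0`. -/
theorem zeroth_order (h : IsPlaneCritical f u i j (Pi.single i 1) (Pi.single j 1) x₀) (hij : i ≠ j)
    (hf : ContDiff ℝ ∞ f) (hu : ContDiff ℝ ∞ u) : var0 i j f u x₀ = 0 := by
  have hab : IsPlaneFrame i j (Pi.single i 1) (Pi.single j 1) :=
    ⟨by simp, by simp [hij.symm], by simp [hij], by simp⟩
  have h0 := contDiff_along hu (contDiff_dU hf)
  have h1 := fun k => contDiff_along hu (contDiff_dU1 hf k)
  have h2 := fun k m => contDiff_along hu (contDiff_dU2 hf k m)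
  have hΓ := contDiff_planeMap x₀ (Pi.single i 1) (Pi.single j 1)
  have key := eq_zero_of_integral_second_order (h0.comp hΓ) ((h1 i).comp hΓ) ((h1 j).comp hΓ)
    ((h2 i i).comp hΓ) ((h2 i j).comp hΓ) ((h2 j j).comp hΓ) (fun w hw hc => ?_) 0
  · have hi : ∀ {g : MultiTime n → ℝ} (z : ℝ × ℝ), ContDiff ℝ ∞ g →
        fderiv ℝ (fun z => g (planeMap x₀ (Pi.single i 1) (Pi.single j 1) z)) z (1, 0)
          = pd i g (planeMap x₀ (Pi.single i 1) (Pi.single j 1) z) := fun z hg => by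
      rw [fderiv_comp_planeMap hg]
      simp [pd]
    have hj : ∀ {g : MultiTime n → ℝ} (z : ℝ × ℝ), ContDiff ℝ ∞ g →
        fderiv ℝ (fun z => g (planeMap x₀ (Pi.single i 1) (Pi.single j 1) z)) z (0, 1)
          = pd j g (planeMap x₀ (Pi.single i 1) (Pi.single j 1) z) := fun z hg => by
      rw [fderiv_comp_planeMap hg]
      simp [pd]
    have hp : planeMap x₀ (Pi.single i 1) (Pi.single j 1) 0 = x₀ := by simp [planeMap]
    simp only [Function.comp_def, hi _ (h2 i i), hj _ (h2 i j), hj _ (h2 j j)] at key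
    rw [hi 0 (((h1 i).sub (contDiff_pd (h2 i i) i)).sub (contDiff_pd (h2 i j) j)),
      hj 0 ((h1 j).sub (contDiff_pd (h2 j j) j)),
      pd_sub ((h1 i).sub (contDiff_pd (h2 i i) i)) (contDiff_pd (h2 i j) j),
      pd_sub (h1 i) (contDiff_pd (h2 i i) i), pd_sub (h1 j) (contDiff_pd (h2 j j) j), hp] at key
    unfold var0
    linarith
  have hW : ContDiff ℝ ∞ fun x => w (planeCoord i j x₀ x) := hw.comp (contDiff_planeCoord i j x₀)
  refine Eq.trans ?_ (h _ hW _ hc (by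
    simpa using tsupport_comp_planeCoord_mul_subset w (fun _ => 1) i j x₀))
  congr 1
  funext z
  have hpdi : pd i (fun x => w (planeCoord i j x₀ x))
      = fun x => (fun z => fderiv ℝ w z (1, 0)) (planeCoord i j x₀ x) :=
    funext fun x => by simp [pd_comp_planeCoord hw, hij]
  have hpdj : pd j (fun x => w (planeCoord i j x₀ x))
      = fun x => (fun z => fderiv ℝ w z (0, 1)) (planeCoord i j x₀ x) :=
    funext fun x => by simp [pd_comp_planeCoord hw, hij.symm]
  have hpd0 : ∀ m, m ≠ i ∧ m ≠ j → pd m (fun x => w (planeCoord i j x₀ x)) = fun _ => 0 :=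
    fun m hm => funext fun x => by simp [pd_comp_planeCoord hw, hm.1, hm.2]
  have hzero : ∀ k x, pd k (fun _ : MultiTime n => (0 : ℝ)) x = 0 := fun k x => by simp [pd]
  have hpd0' : ∀ k m, k ≠ i ∧ k ≠ j → ∀ x, pd k (pd m fun x => w (planeCoord i j x₀ x)) x = 0 :=
    fun k m hk x => by rw [pd_pd_comm hW, hpd0 k hk, hzero]
  rw [variation_eq _ _ hW, Fintype.sum_eq_add i j hij fun m hm => by rw [hpd0 m hm, mul_zero],
    Fintype.sum_eq_add i j hij fun k hk => Finset.sum_eq_zero fun m _ => by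
      rw [hpd0' k m hk, mul_zero],
    Fintype.sum_eq_add i j hij fun m hm => by rw [hpd0 m hm, hzero, mul_zero],
    Fintype.sum_eq_add i j hij fun m hm => by rw [hpd0 m hm, hzero, mul_zero],
    pd_pd_comm hW i j, hpdi, hpdj, pd_comp_planeCoord (contDiff_fderiv_apply hw (1, 0)),
    pd_comp_planeCoord (contDiff_fderiv_apply hw (1, 0)),
    pd_comp_planeCoord (contDiff_fderiv_apply hw (0, 1)), hab.planeCoord_planeMap]
  simp only [Function.comp_apply, hab.planeCoord_planeMap, along, momentum2, if_true,
    hij, hij.symm, if_false,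
    dU2_comm j i, add_zero, zero_add]
  ring

end IsPlaneCritical

/-! ### Criticality implies the multi-time Euler–Lagrange equations -/

theorem planeCoeff_single (L : Fin n → Fin n → Jet2 n → ℝ) (i j : Fin n) :
    planeCoeff L (Pi.single i 1) (Pi.single j 1) = L i j := by
  funext p
  simp [planeCoeff, Pi.single_apply]

theorem sum_mul_single (F : Fin n → ℝ) (i : Fin n) (c : ℝ) :
    ∑ l, F l * (Pi.single i c : Fin n → ℝ) l = F i * c := by
  simp [Pi.single_apply]

theorem sum_mul_ite_add_ite_add_ite (F : Fin n → ℝ) (i j k : Fin n) (c₁ c₂ c₃ : ℝ) :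
    ∑ l, F l * ((if l = i then c₁ else 0) + (if l = j then c₂ else 0) + (if l = k then c₃ else 0))
      = F i * c₁ + F j * c₂ + F k * c₃ := by
  simp [mul_add, Finset.sum_add_distrib]

theorem sum_sum_mul_ite_add_ite_add_ite (F : Fin n → Fin n → ℝ) (i j k : Fin n) (c₁ c₂ c₃ : ℝ)
    {ξ : Fin n → ℝ} (hξ : ξ = fun l =>
      (if l = i then c₁ else 0) + (if l = j then c₂ else 0) + (if l = k then c₃ else 0)) :
    ∑ l, ∑ m, F l m * (ξ l * ξ m)
      = (F i i * c₁ + F i j * c₂ + F i k * c₃) * c₁ + (F j i * c₁ + F j j * c₂ + F j k * c₃) * c₂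
        + (F k i * c₁ + F k j * c₂ + F k k * c₃) * c₃ := by
  have : ∀ l, ∑ m, F l m * (ξ l * ξ m) = (F l i * c₁ + F l j * c₂ + F l k * c₃) * ξ l := by
    intro l
    rw [← sum_mul_ite_add_ite_add_ite (F l), Finset.sum_mul]
    refine Finset.sum_congr rfl fun m _ => ?_
    rw [hξ]
    ring
  simp only [this]
  rw [hξ]
  exact sum_mul_ite_add_ite_add_ite (fun l => F l i * c₁ + F l j * c₂ + F l k * c₃) i j k c₁ c₂ c₃

section Critical

variable {L : Fin n → Fin n → Jet2 n → ℝ} {u : MultiTime n → ℝ}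

theorem isPlaneCritical_coordinate (hL : ∀ i j, ContDiff ℝ ∞ (L i j))
    (hskew : ∀ i j p, L i j p = -L j i p) (hu : ContDiff ℝ ∞ u)
    (h : ∀ S : Surface n, IsCriticalOn L S u) {i j : Fin n} (hij : i ≠ j) (x : MultiTime n) :
    IsPlaneFrame i j (Pi.single i 1) (Pi.single j 1)
      ∧ IsPlaneCritical (L i j) u i j (Pi.single i 1) (Pi.single j 1) x := by
  have hab : IsPlaneFrame i j (Pi.single i (1 : ℝ)) (Pi.single j 1) :=
    ⟨by simp, by simp [hij.symm], by simp [hij], by simp⟩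
  have := isPlaneCritical_planeCoeff hL hskew hu h hab x
  rw [planeCoeff_single] at this
  exact ⟨hab, this⟩

theorem two_mul_along_momentum2 {k m : Fin n} (hkm : k ≠ m) (f : Jet2 n → ℝ) (x : MultiTime n) :
    2 * along u (momentum2 k m f) x = var2 k m f u x := by
  simp [along, momentum2, hkm, var2]
  ring

theorem along_momentum2_self (k : Fin n) (f : Jet2 n → ℝ) (x : MultiTime n) :
    along u (momentum2 k k f) x = var2 k k f u x := by
  simp [along, momentum2, var2]

theorem var1_eq_zero_of_critical (hL : ∀ i j, ContDiff ℝ ∞ (L i j))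
    (hskew : ∀ i j p, L i j p = -L j i p) (hu : ContDiff ℝ ∞ u)
    (h : ∀ S : Surface n, IsCriticalOn L S u) {i j k : Fin n} (hij : i ≠ j) (hki : k ≠ i)
    (hkj : k ≠ j) (x : MultiTime n) : var1 i j k (L i j) u x = 0 := by
  obtain ⟨hab, hc⟩ := isPlaneCritical_coordinate hL hskew hu h hij x
  have := hc.first_order hab (hL i j) hu (ξ := Pi.single k 1)
    (by simp [sum_mul_single, hki.symm]) (by simp [sum_mul_single, hkj.symm])
  simp only [sum_mul_single, mul_one, two_mul_along_momentum2 hki.symm,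
    two_mul_along_momentum2 hkj.symm] at this
  exact this

/-- Polarization: the quadratic form of the momenta vanishes on every $c\,e_k+d\,e_m$ conormal to
the coordinate plane. -/
theorem var2_eq_zero_of_critical (hL : ∀ i j, ContDiff ℝ ∞ (L i j))
    (hskew : ∀ i j p, L i j p = -L j i p) (hu : ContDiff ℝ ∞ u)
    (h : ∀ S : Surface n, IsCriticalOn L S u) {i j k m : Fin n} (hij : i ≠ j) (hki : k ≠ i)
    (hkj : k ≠ j) (hmi : m ≠ i) (hmj : m ≠ j) (x : MultiTime n) : var2 k m (L i j) u x = 0 := by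
  obtain ⟨hab, hc⟩ := isPlaneCritical_coordinate hL hskew hu h hij x
  -- The third slot is idle, with coefficient 0; its index `m` is a filler.
  have key : ∀ c d : ℝ, _ := fun c d => sum_sum_mul_ite_add_ite_add_ite
    (fun k m => along u (momentum2 k m (L i j)) x) k m m c d 0 rfl
  have key' : ∀ c d : ℝ, _ := fun c d => (key c d).symm.trans
    (hc.sum_momentum2_eq_zero hab (hL i j) hu (by simp [sum_mul_single, hki.symm, hmi.symm])
      (by simp [sum_mul_single, hkj.symm, hmj.symm]))
  have h1 := key' 1 0
  have h2 := key' 0 1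
  have h3 := key' 1 1
  by_cases hkm : k = m
  · subst hkm
    rw [← along_momentum2_self]
    linarith
  · rw [← two_mul_along_momentum2 hkm]
    rw [momentum2_comm m k] at h3
    linarith

/-! ### Planes tilted toward a third coordinate -/

/-- The coefficient of the 2-form in a plane that projects onto the `(x^i, x^j)`-plane and is tilted
in the direction of `x^k`. -/
def tilted (L : Fin n → Fin n → Jet2 n → ℝ) (i j k : Fin n) (α β : ℝ) (p : Jet2 n) : ℝ :=
  L i j p + β * L i k p + α * L k j p

theorem contDiff_tilted (hL : ∀ i j, ContDiff ℝ ∞ (L i j)) (i j k : Fin n) (α β : ℝ) :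
    ContDiff ℝ ∞ (tilted L i j k α β) :=
  ((hL i j).add (contDiff_const.mul (hL i k))).add (contDiff_const.mul (hL k j))

theorem fderiv_tilted (hL : ∀ i j, ContDiff ℝ ∞ (L i j)) (i j k : Fin n) (α β : ℝ) (p q : Jet2 n) :
    fderiv ℝ (tilted L i j k α β) p q
      = fderiv ℝ (L i j) p q + β * fderiv ℝ (L i k) p q + α * fderiv ℝ (L k j) p q := by
  have hd : ∀ i j, HasFDerivAt (L i j) (fderiv ℝ (L i j) p) p := fun i j =>
    ((hL i j).differentiable (by simp) p).hasFDerivAt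
  have := (((hd i j).add ((hd i k).const_mul β)).add ((hd k j).const_mul α)).fderiv
  exact congrArg (fun A : Jet2 n →L[ℝ] ℝ => A q) this

theorem var2_tilted (hL : ∀ i j, ContDiff ℝ ∞ (L i j)) (i j k : Fin n) (α β : ℝ) (l m : Fin n)
    (x : MultiTime n) : var2 l m (tilted L i j k α β) u x
      = var2 l m (L i j) u x + β * var2 l m (L i k) u x + α * var2 l m (L k j) u x :=
  fderiv_tilted hL i j k α β _ _

theorem isPlaneCritical_tilted (hL : ∀ i j, ContDiff ℝ ∞ (L i j))
    (hskew : ∀ i j p, L i j p = -L j i p) (hu : ContDiff ℝ ∞ u)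
    (h : ∀ S : Surface n, IsCriticalOn L S u) {i j k : Fin n} (hij : i ≠ j) (hki : k ≠ i)
    (hkj : k ≠ j) (α β : ℝ) (x : MultiTime n) :
    IsPlaneFrame i j (Pi.single i 1 + Pi.single k α) (Pi.single j 1 + Pi.single k β)
      ∧ IsPlaneCritical (tilted L i j k α β) u i j (Pi.single i 1 + Pi.single k α)
        (Pi.single j 1 + Pi.single k β) x := by
  have hab : IsPlaneFrame i j (Pi.single i 1 + Pi.single k α) (Pi.single j 1 + Pi.single k β) :=
    ⟨by simp [hki.symm], by simp [hij.symm, hkj.symm], by simp [hij, hki.symm], by simp [hkj.symm]⟩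
  have := isPlaneCritical_planeCoeff hL hskew hu h hab x
  have he : planeCoeff L (Pi.single i 1 + Pi.single k α) (Pi.single j 1 + Pi.single k β)
      = tilted L i j k α β := by
    funext p
    have h0 : L k k p = 0 := by linarith [hskew k k p]
    simp [planeCoeff, tilted, Pi.single_apply, add_mul, mul_add, Finset.sum_add_distrib, h0,
      ite_mul, mul_ite]
    ring
  rw [he] at this
  exact ⟨hab, this⟩

/-- The covector $-\alpha e_i-\beta e_j+e_k$ is conormal to the tilted plane, as `first_order` and
`sum_momentum2_eq_zero` require. -/
theorem sum_tiltedCovector (i j k : Fin n) (hij : i ≠ j) (hki : k ≠ i) (hkj : k ≠ j) (α β : ℝ) :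
    (∑ l, ((if l = i then -α else 0) + (if l = j then -β else 0) + (if l = k then 1 else 0))
      * (Pi.single i 1 + Pi.single k α : Fin n → ℝ) l = 0) ∧
    ∑ l, ((if l = i then -α else 0) + (if l = j then -β else 0) + (if l = k then 1 else 0))
      * (Pi.single j 1 + Pi.single k β : Fin n → ℝ) l = 0 := by
  simp only [mul_comm _ ((_ : Fin n → ℝ) _), sum_mul_ite_add_ite_add_ite]
  simp [hij, hij.symm, hki, hki.symm, hkj, hkj.symm]

/-- Quadratic normal condition on the tilted plane. As `f` also depends on the tilt, it is a
polynomial identity in $\alpha,\beta$, from which suitable values extract relations between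
different coefficients. -/
theorem second_order_of_critical (hL : ∀ i j, ContDiff ℝ ∞ (L i j))
    (hskew : ∀ i j p, L i j p = -L j i p) (hu : ContDiff ℝ ∞ u)
    (h : ∀ S : Surface n, IsCriticalOn L S u) {i j k : Fin n} (hij : i ≠ j) (hki : k ≠ i)
    (hkj : k ≠ j) (α β : ℝ) (x : MultiTime n) {f : Jet2 n → ℝ} (hf : f = tilted L i j k α β) :
    α * α * var2 i i f u x + β * β * var2 j j f u x + var2 k k f u x + α * β * var2 i j f u x
      - α * var2 i k f u x - β * var2 j k f u x = 0 := by
  subst hf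
  obtain ⟨hab, hc⟩ := isPlaneCritical_tilted hL hskew hu h hij hki hkj α β x
  obtain ⟨ha, hb⟩ := sum_tiltedCovector i j k hij hki hkj α β
  have h1 := hc.sum_momentum2_eq_zero hab (contDiff_tilted hL i j k α β) hu ha hb
  have h2 := sum_sum_mul_ite_add_ite_add_ite
    (fun l m => along u (momentum2 l m (tilted L i j k α β)) x) i j k (-α) (-β) 1 rfl
  rw [momentum2_comm j i, momentum2_comm k i, momentum2_comm k j] at h2
  rw [← two_mul_along_momentum2 hij, ← two_mul_along_momentum2 hki.symm,
    ← two_mul_along_momentum2 hkj.symm, ← along_momentum2_self, ← along_momentum2_self,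
    ← along_momentum2_self]
  linear_combination h1 - h2

/-- For $\alpha=0$, the part of the identity odd in $\beta$, read off from $\beta=\pm1$, involves
three momenta, and the one of $L_{ik}$ in direction $jj$ is already zero. -/
theorem var2_eq_var2_of_critical (hL : ∀ i j, ContDiff ℝ ∞ (L i j))
    (hskew : ∀ i j p, L i j p = -L j i p) (hu : ContDiff ℝ ∞ u)
    (h : ∀ S : Surface n, IsCriticalOn L S u) {i j k : Fin n} (hji : j ≠ i) (hki : k ≠ i)
    (x : MultiTime n) : var2 j k (L i j) u x = var2 k k (L i k) u x := by
  by_cases hkj : k = j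
  · rw [hkj]
  have h1 := second_order_of_critical hL hskew hu h hji.symm hki hkj 0 1 x rfl
  have h2 := second_order_of_critical hL hskew hu h hji.symm hki hkj 0 (-1) x rfl
  simp only [var2_tilted hL] at h1 h2
  have h3 := var2_eq_zero_of_critical hL hskew hu h hji.symm hki hkj hki hkj x
  have h4 := var2_eq_zero_of_critical hL hskew hu h hki.symm hji (Ne.symm hkj) hji (Ne.symm hkj) x
  linarith

theorem cyclic_of_critical (hL : ∀ i j, ContDiff ℝ ∞ (L i j))
    (hskew : ∀ i j p, L i j p = -L j i p) (hu : ContDiff ℝ ∞ u)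
    (h : ∀ S : Surface n, IsCriticalOn L S u) {i j k : Fin n} (hij : i ≠ j) (hjk : j ≠ k)
    (hki : k ≠ i) (x : MultiTime n) :
    var2 i j (L i j) u x + var2 j k (L j k) u x + var2 k i (L k i) u x = 0 := by
  -- At $\alpha=\beta=1$ there are eighteen momenta. Six vanish, three for each coefficient... of
  -- purely normal type being removed by `z1`–`z3` and the others cancelling in pairs through
  -- `e1`–`e6` and skewness, which leaves the cyclic sum.
  have h1 := second_order_of_critical hL hskew hu h hij hki hjk.symm 1 1 x rfl
  simp only [var2_tilted hL] at h1
  have z1 := var2_eq_zero_of_critical hL hskew hu h hij hki hjk.symm hki hjk.symm x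
  have z2 := var2_eq_zero_of_critical hL hskew hu h hki.symm hij.symm hjk hij.symm hjk x
  have z3 := var2_eq_zero_of_critical hL hskew hu h hjk.symm hki.symm hij hki.symm hij x
  have e : ∀ {a b c : Fin n}, b ≠ a → c ≠ a → var2 b c (L a b) u x = var2 c c (L a c) u x :=
    fun hb hc => var2_eq_var2_of_critical hL hskew hu h hb hc x
  have s : ∀ a b c d, var2 c d (L a b) u x = - var2 c d (L b a) u x := fun a b c d =>
    var2_skew hskew a b c d u x
  have e1 := e hij.symm hki
  have e2 := e hki hij.symm
  have e3 := e hij hjk.symm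
  have e4 := e hjk.symm hij
  have e5 := e hki.symm hjk
  have e6 := e hjk hki.symm
  rw [var2_comm k j] at e2
  rw [var2_comm k i] at e4
  rw [var2_comm j i] at e6
  linarith [s j i i i, s j i i k, s k i i i, s k i i j, s k i i k, s k j i j, s k j j j, s j k j k,
    s k j j k, s k j i i, s j k i k, s j k k k, s k i j k, var2_comm k i (L k i) u x]

/-- Apply `first_order` on the plane spanned by $e_i$ and $e_j+e_k$ with conormal $e_k-e_j$.
Subtracting the known equations for `var1 i j k (L i j)` and `var1 i k j (L i k)`, and identifying
equal second-order momenta, leaves the difference of the two sides. -/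
theorem var1_eq_var1_of_critical (hL : ∀ i j, ContDiff ℝ ∞ (L i j))
    (hskew : ∀ i j p, L i j p = -L j i p) (hu : ContDiff ℝ ∞ u)
    (h : ∀ S : Surface n, IsCriticalOn L S u) {i j k : Fin n} (hji : j ≠ i) (hki : k ≠ i)
    (x : MultiTime n) : var1 i j j (L i j) u x = var1 i k k (L i k) u x := by
  by_cases hkj : k = j
  · rw [hkj]
  obtain ⟨hab, hc⟩ := isPlaneCritical_tilted hL hskew hu h hji.symm hki hkj 0 1 x
  obtain ⟨ha, hb⟩ := sum_tiltedCovector i j k hji.symm hki hkj 0 1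
  have h1 := hc.first_order hab (contDiff_tilted hL i j k 0 1) hu ha hb
  have hV : ∀ a b c d, ContDiff ℝ ∞ (var2 c d (L a b) u) := fun a b c d =>
    contDiff_var2 (hL a b) hu c d
  have hi : (fun x => (2 * along u (momentum2 i i (tilted L i j k 0 1)) x * -0
      + 2 * along u (momentum2 i j (tilted L i j k 0 1)) x * -1
      + 2 * along u (momentum2 i k (tilted L i j k 0 1)) x * 1))
      = fun x => (var2 i k (L i j) u x + var2 i k (L i k) u x)
        - (var2 i j (L i j) u x + var2 i j (L i k) u x) := by
    funext x
    rw [two_mul_along_momentum2 hji.symm, two_mul_along_momentum2 hki.symm, var2_tilted hL,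
      var2_tilted hL]
    ring
  -- The contributions of $L_{ik}$ disappear: its $jj$ momentum is zero, and its $jk$ momentum
  -- equals the $jj$ momentum of $L_{ij}$, which reduces the coefficient $-2$ to $-1$.
  have hj : (fun x => (2 * along u (momentum2 j i (tilted L i j k 0 1)) x * -0
      + 2 * along u (momentum2 j j (tilted L i j k 0 1)) x * -1
      + 2 * along u (momentum2 j k (tilted L i j k 0 1)) x * 1))
      = fun x => var2 j k (L i j) u x - var2 j j (L i j) u x := by
    funext x
    rw [two_mul_along_momentum2 (Ne.symm hkj), along_momentum2_self, var2_tilted hL,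
      var2_tilted hL]
    have e1 := var2_eq_zero_of_critical hL hskew hu h hki.symm hji (Ne.symm hkj) hji (Ne.symm hkj) x
    have e2 := var2_eq_var2_of_critical hL hskew hu h hki hji x
    rw [var2_comm] at e2
    linarith
  simp only [sum_mul_ite_add_ite_add_ite] at h1
  rw [hi, hj, fderiv_eq_sum_pd, fderiv_eq_sum_pd] at h1
  have hs : ∀ (F : Fin n → ℝ) (l : Fin n) (c : ℝ),
      ∑ m, (Pi.single l 1 + Pi.single k c : Fin n → ℝ) m * F m = F l + c * F k := by
    intro F l c
    simp only [mul_comm _ (F _), Pi.add_apply, mul_add, Finset.sum_add_distrib, sum_mul_single]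
    ring
  rw [hs, hs, pd_sub ((hV _ _ _ _).add (hV _ _ _ _)) ((hV _ _ _ _).add (hV _ _ _ _)),
    pd_add (hV _ _ _ _) (hV _ _ _ _), pd_add (hV _ _ _ _) (hV _ _ _ _),
    pd_sub (hV _ _ _ _) (hV _ _ _ _), pd_sub (hV _ _ _ _) (hV _ _ _ _)] at h1
  have hA : ∀ l, along u (dU1 l (tilted L i j k 0 1)) x
      = along u (dU1 l (L i j)) x + along u (dU1 l (L i k)) x := fun l => by
    have := fderiv_tilted hL i j k 0 1 (jet2 u x) (0, Pi.single l 1, 0)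
    rw [one_mul, zero_mul, add_zero] at this
    exact this
  rw [hA, hA, hA] at h1
  have h2 := var1_eq_zero_of_critical hL hskew hu h hji.symm hki hkj x
  have h3 := var1_eq_zero_of_critical hL hskew hu h hki.symm hji (Ne.symm hkj) x
  have e1 : var2 j k (L i j) u = var2 k k (L i k) u :=
    funext fun x => var2_eq_var2_of_critical hL hskew hu h hji hki x
  have e2 : var2 k j (L i k) u = var2 j j (L i j) u :=
    funext fun x => var2_eq_var2_of_critical hL hskew hu h hki hji x
  have hvar1 : ∀ a b c (f : Jet2 n → ℝ), var1 a b c f u x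
      = along u (dU1 c f) x - pd a (var2 a c f u) x - pd b (var2 b c f u) x := fun _ _ _ _ => rfl
  rw [hvar1] at h2 h3 ⊢
  rw [hvar1, ← e1]
  rw [e2] at h3
  linarith

end Critical

theorem multiTimeEL_of_isCriticalOn {L : Fin n → Fin n → Jet2 n → ℝ} {u : MultiTime n → ℝ}
    (hL : ∀ i j, ContDiff ℝ ∞ (L i j))
    (hskew : ∀ i j p, L i j p = -L j i p) (hu : ContDiff ℝ ∞ u)
    (h : ∀ S : Surface n, IsCriticalOn L S u) : MultiTimeEL L u where
  eq_u i j hij x := (isPlaneCritical_coordinate hL hskew hu h hij x).2.zeroth_order hij (hL i j) hu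
  eq_uk _ _ _ hij hki hkj x := var1_eq_zero_of_critical hL hskew hu h hij hki hkj x
  eq_ukm _ _ _ _ hij hki hkj hmi hmj x :=
    var2_eq_zero_of_critical hL hskew hu h hij hki hkj hmi hmj x
  indep_uj _ _ _ hj hj' x := var1_eq_var1_of_critical hL hskew hu h hj hj' x
  indep_ujk _ _ _ _ hk hj hj' x :=
    (var2_eq_var2_of_critical hL hskew hu h hj hk x).trans
      (var2_eq_var2_of_critical hL hskew hu h hj' hk x).symm
  cyclic _ _ _ hij hjk hki x := cyclic_of_critical hL hskew hu h hij hjk hki x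

end PluriLagrangian
end

theorem theorem2 (n : ℕ)
    (L : Fin n → Fin n → PluriLagrangian.Jet2 n → ℝ)
    (hL : ∀ i j, ContDiff ℝ ∞ (L i j))
    (hskew : ∀ i j p, L i j p = -L j i p)
    (u : PluriLagrangian.MultiTime n → ℝ) (hu : ContDiff ℝ ∞ u) :
    (∀ S : PluriLagrangian.Surface n, PluriLagrangian.IsCriticalOn L S u) ↔
      PluriLagrangian.MultiTimeEL L u :=
  ⟨PluriLagrangian.multiTimeEL_of_isCriticalOn hL hskew hu,
    fun h S => h.isCriticalOn hL hskew hu S⟩
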